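/- For $f:\{0,1\}^n\to\{0,1\}$ and uniformly random $x\in\{0,1\}^n$, let $\mu=\mathbb{E}[f(x)]$, and let $I(f)=\sum_{k=1}^n\Pr[f(x)\ne f(x\oplus e_k)]$ be the total influence of $f$, where $x\oplus e_k$ is $x$ with its $k$-th coordinate flipped. A term is an AND of literals (variables or negated variables) in which no variable occurs together with its negation; a DNF is an OR of finitely many terms (the empty OR being the constant $0$); its size is the number of its terms and its width is the maximal number of literals in a term ($0$ for the empty DNF). A DNF $D$ $\delta$-approximates $f$ if $\Pr[f(x)\neq D(x)]\le\delta$. All logarithms are to base $2$, and $\log(1/\mu)$ is read as $0$ if $\mu=0$. **Theorem.** There is an absolute constant $C>0$ such that for all real $M,\varepsilon>0$ there is a nonnegative integer $s=s(M,\varepsilon)\le 2^{2^{C M/\varepsilon}}$ with the following property. Let $n\ge 0$ and let $f:\{0,1\}^n\to\{0,1\}$ have $\mathbb{E}[f]=\mu$ and $$I(f)\le 2\mu\left(\log(1/\mu)+M\right).$$ Then $f$ can be $\varepsilon\mu$-approximated by a DNF of size at most $s$ (i.e. a union of at most $s$ subcubes). Moreover, $f$ can be $\varepsilon\mu$-approximated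 by a DNF of width at most $\log(1/\mu)+2^{C M/\varepsilon}$ (i.e. a union of subcubes of co-dimension at most $\log(1/\mu)+2^{C M/\varepsilon}$). -/

import Mathlib

namespace BoolFun

/-- The discrete cube `{0,1}^n`. -/
abbrev Cube (n : ℕ) : Type := Fin n → Bool

/-- The probability of an event for a uniformly random point of the cube. -/
noncomputable def prob {n : ℕ} (p : Cube n → Prop) [DecidablePred p] : ℝ :=
  ((Finset.univ.filter p).card : ℝ) / 2 ^ n

/-- The expectation `E[f]` of a Boolean function under the uniform measure. -/
noncomputable def mean {n : ℕ} (f : Cube n → Bool) : ℝ :=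
  (∑ x : Cube n, if f x = true then (1 : ℝ) else 0) / 2 ^ n

/-- The point `x ⊕ e_k`. -/
def flipCoord {n : ℕ} (k : Fin n) (x : Cube n) : Cube n :=
  Function.update x k (!(x k))

/-- The influence `I_k(f)` of the coordinate `k`. -/
noncomputable def influence {n : ℕ} (f : Cube n → Bool) (k : Fin n) : ℝ :=
  prob fun x => f x ≠ f (flipCoord k x)

/-- The total influence `I(f)`. -/
noncomputable def totalInfluence {n : ℕ} (f : Cube n → Bool) : ℝ :=
  ∑ k : Fin n, influence f k

/-- `g` is a `δ`-approximation of `f`. -/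
def Approximates {n : ℕ} (δ : ℝ) (g f : Cube n → Bool) : Prop :=
  prob (fun x => f x ≠ g x) ≤ δ

/-- A literal in `n` variables: `(i, true)` is the variable `x_i`, and `(i, false)` is its
negation. -/
abbrev Literal (n : ℕ) : Type := Fin n × Bool

/-- A term is an AND of literals. No variable occurs together with its negation, so that
the points satisfying a term form a (nonempty) subcube, whose co-dimension is the number of
literals. -/
structure Term (n : ℕ) where
  literals : Finset (Literal n)
  consistent : ∀ i : Fin n, ¬ ((i, true) ∈ literals ∧ (i, false) ∈ literals)

/-- The Boolean function computed by a term. -/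
def Term.eval {n : ℕ} (T : Term n) (x : Cube n) : Bool :=
  decide (∀ l ∈ T.literals, x l.1 = l.2)

/-- A DNF is an OR of terms `T_1 ∨ ⋯ ∨ T_s`; the empty OR is the constant `0`. -/
structure DNF (n : ℕ) where
  terms : List (Term n)

/-- The Boolean function computed by a DNF. -/
def DNF.eval {n : ℕ} (D : DNF n) (x : Cube n) : Bool :=
  D.terms.any fun T => T.eval x

/-- The number of terms. -/
def DNF.size {n : ℕ} (D : DNF n) : ℕ := D.terms.length

/-- The maximal number of literals in a term (`0` for the empty DNF). -/
def DNF.width {n : ℕ} (D : DNF n) : ℕ :=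
  D.terms.foldr (fun T w => max T.literals.card w) 0

end BoolFun

/-!
Let `A` be the set where `f = 1` and let `X` be uniform on `A`. The entropy of `X` is at least the
sum of the conditional entropies of its coordinates given all other coordinates; this is the
edge-isoperimetric inequality, and `excess A ≤ M |A|` is a reformulation of the hypothesis on the
total influence: `excess A` is `|A| log |A|` minus the sum of the degrees of the graph induced on
`A`. Under a split of `A` along a coordinate, the excess is the sum of the excesses of the halves
plus a nonnegative loss. The loss is at least the boundary in the direction of the split times the
proportion of the smaller half (`excess_split_ge`), and it is large relative to a very small half
(`splitEntropy_ge_of_unbalanced`).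

Hence `A` can be split along directions of large boundary, each proper split lowering the excess by
a fixed multiple of the number of points that are split, while very small halves are discarded at a
cost bounded by the excess (`exists_subcubes_of_fiber`). Few proper splits are possible on most branches. What remains are
subcubes in which `A` has a small boundary in every free direction. In these `A` is nearly
everything or nearly nothing, on the average: by `excess_ge_of_bdry_le`, if all boundaries are at
most `2 ^ (-Λ) |A|`, then the excess is at least of order `Λ |A| (1 - μ)`, where `μ` is the
density of `A`.

This last inequality has two cases. If `log (1 / μ)` is at most a small multiple of `Λ`, it
follows from the Kahn-Kalai-Linial inequality, which is proved by hypercontractivity. Otherwise, the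
entropy proof of edge isoperimetry is used once more. For each set `R` of coordinates, the mutual
information of `X` on `R` and `X` off `R` is at most the excess per point
(`mutual_information_le`). If the excess is small compared with `log (1 / μ)`, then, for a suitable
`R`, many directions of boundary edges at a typical point are determined by its coordinates in `R`,
and also by those outside `R`. For independent halves of two points of `A`, both predictions of the
same direction hardly ever occur, since every direction carries a small part of the boundary.
So the mutual information is at least of order `Λ` (`excess_ge_of_small_density`).
-/

namespace BoolFun

open Finset

/-! ### Fibers and entropy -/

section Flip

variable {ι : Type*} [DecidableEq ι]

/-- The point `x` with its coordinate `k` flipped. -/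
def flipAt (k : ι) (x : ι → Bool) : ι → Bool := Function.update x k (!x k)

lemma flipAt_flipAt (k : ι) (x : ι → Bool) : flipAt k (flipAt k x) = x := by
  ext i; by_cases h : i = k <;> simp [flipAt, h]

lemma flipAt_same (k : ι) (x : ι → Bool) : flipAt k x k = !x k := by simp [flipAt]

lemma flipAt_of_ne {k i : ι} (h : i ≠ k) (x : ι → Bool) : flipAt k x i = x i := by
  simp [flipAt, h]

lemma flipAt_ne (k : ι) (x : ι → Bool) : flipAt k x ≠ x := by
  intro h
  have := congrFun h k
  simp [flipAt] at this

end Flip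

section Entropy

variable {ι : Type*} [Fintype ι] [DecidableEq ι]

/-- The points of `A` that agree with `x` on the coordinates in `R`. -/
def fiber (A : Finset (ι → Bool)) (R : Finset ι) (x : ι → Bool) : Finset (ι → Bool) :=
  A.filter fun y => ∀ i ∈ R, y i = x i

/-- `|A|` times the conditional entropy of `X` given its coordinates in `R`, for `X` uniform
on `A`. -/
noncomputable def fiberEntropy (A : Finset (ι → Bool)) (R : Finset ι) : ℝ :=
  ∑ x ∈ A, Real.logb 2 ((fiber A R x).card : ℝ)

/-- The number of points of `A` whose neighbour in direction `k` is in `A`. -/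
def inner (A : Finset (ι → Bool)) (k : ι) : ℕ := (A.filter fun x => flipAt k x ∈ A).card

/-- The number of points of `A` whose neighbour in direction `k` is not in `A`. -/
def bdry (A : Finset (ι → Bool)) (k : ι) : ℕ := (A.filter fun x => flipAt k x ∉ A).card

/-- `|A|` times the amount by which the average number of boundary edges at a point of `A`
exceeds the edge-isoperimetric bound `log (2 ^ n / |A|)`. Since every point has as many
boundary edges as it lacks neighbours in `A`, the dimension cancels. -/
noncomputable def excess (A : Finset (ι → Bool)) : ℝ :=
  (A.card : ℝ) * Real.logb 2 A.card - ∑ k, (inner A k : ℝ)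

lemma mem_fiber {A : Finset (ι → Bool)} {R : Finset ι} {x y : ι → Bool} :
    y ∈ fiber A R x ↔ y ∈ A ∧ ∀ i ∈ R, y i = x i := by simp [fiber]

lemma self_mem_fiber {A : Finset (ι → Bool)} {R : Finset ι} {x : ι → Bool} (hx : x ∈ A) :
    x ∈ fiber A R x := mem_fiber.2 ⟨hx, fun _ _ => rfl⟩

lemma fiber_card_pos {A : Finset (ι → Bool)} {R : Finset ι} {x : ι → Bool} (hx : x ∈ A) :
    0 < ((fiber A R x).card : ℝ) := by
  exact_mod_cast card_pos.2 ⟨x, self_mem_fiber hx⟩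

lemma fiber_congr {A : Finset (ι → Bool)} {R : Finset ι} {x y : ι → Bool}
    (h : ∀ i ∈ R, y i = x i) : fiber A R y = fiber A R x := by
  ext z
  simp only [mem_fiber]
  refine and_congr_right fun _ => forall₂_congr fun i hi => ?_
  rw [h i hi]

lemma fiber_eq_of_mem {A : Finset (ι → Bool)} {R : Finset ι} {x y : ι → Bool}
    (h : y ∈ fiber A R x) : fiber A R y = fiber A R x := fiber_congr (mem_fiber.1 h).2

lemma mem_fiber_comm {A : Finset (ι → Bool)} {R : Finset ι} {x y : ι → Bool} :
    x ∈ A ∧ y ∈ fiber A R x ↔ x ∈ fiber A R y ∧ y ∈ A := by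
  simp only [mem_fiber]
  constructor
  · rintro ⟨h1, h2, h3⟩
    exact ⟨⟨h1, fun i hi => (h3 i hi).symm⟩, h2⟩
  · rintro ⟨⟨h1, h3⟩, h2⟩
    exact ⟨h1, h2, fun i hi => (h3 i hi).symm⟩

lemma fiber_empty (A : Finset (ι → Bool)) (x : ι → Bool) : fiber A ∅ x = A := by
  ext; simp [mem_fiber]

lemma inner_add_bdry (A : Finset (ι → Bool)) (k : ι) : inner A k + bdry A k = A.card := by
  simpa [inner, bdry] using Finset.card_filter_add_card_filter_not (s := A) (fun x => flipAt k x ∈ A)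

/-- Averaging a function over the fibers does not change its sum. -/
lemma sum_fiber_average (A : Finset (ι → Bool)) (R : Finset ι) (g : (ι → Bool) → ℝ) :
    ∑ x ∈ A, (∑ y ∈ fiber A R x, g y) / (fiber A R x).card = ∑ y ∈ A, g y := by
  simp_rw [Finset.sum_div]
  rw [Finset.sum_comm' (s' := fun y => fiber A R y) (t' := A) (fun x y => mem_fiber_comm)]
  refine Finset.sum_congr rfl fun y hy => ?_
  have : ∀ x ∈ fiber A R y, g y / ((fiber A R x).card : ℝ) = g y / (fiber A R y).card :=
    fun x hx => by rw [fiber_eq_of_mem hx]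
  rw [Finset.sum_congr rfl this, Finset.sum_const, nsmul_eq_mul]
  field_simp [(fiber_card_pos (R := R) hy).ne']

lemma logb_two_le (t : ℝ) (ht : 0 < t) : Real.logb 2 t ≤ (t - 1) / Real.log 2 := by
  have h2 : 0 < Real.log 2 := Real.log_pos (by norm_num)
  rw [Real.logb]
  gcongr
  exact Real.log_le_sub_one_of_pos ht

/-- Submodularity of entropy: conditioning on more coordinates decreases the conditional
entropy of the coordinate `k`. -/
lemma fiberEntropy_submodular (A : Finset (ι → Bool)) {S S' : Finset ι} (h : S ⊆ S') (k : ι) :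
    fiberEntropy A S' - fiberEntropy A (insert k S') ≤
      fiberEntropy A S - fiberEntropy A (insert k S) := by
  have h2 : 0 < Real.log 2 := Real.log_pos (by norm_num)
  set t : (ι → Bool) → ℝ := fun x =>
    ((fiber A S' x).card : ℝ) * (fiber A (insert k S) x).card /
      ((fiber A (insert k S') x).card * (fiber A S x).card) with ht
  have key : ∑ x ∈ A, t x ≤ A.card := by
    have e1 : ∀ x ∈ A, t x = ∑ y ∈ fiber A S' x, ((fiber A (insert k S) x).card : ℝ) /
      ((fiber A (insert k S') x).card * (fiber A S x).card) := by
      intro x hx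
      rw [Finset.sum_const, nsmul_eq_mul, ht]
      ring
    rw [Finset.sum_congr rfl e1,
      Finset.sum_comm' (s' := fun y => fiber A S' y) (t' := A) (fun x y => mem_fiber_comm)]
    have e2 : ∀ y ∈ A, ∑ x ∈ fiber A S' y, ((fiber A (insert k S) x).card : ℝ) /
      ((fiber A (insert k S') x).card * (fiber A S x).card) ≤ 1 := by
      intro y hy
      have hy' := fiber_card_pos (R := S) hy
      -- on the part of the fiber with `x k = b` the summand is constant
      have e3 : ∀ b : Bool, ∑ x ∈ (fiber A S' y).filter (fun x => x k = b),
          ((fiber A (insert k S) x).card : ℝ) /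
            ((fiber A (insert k S') x).card * (fiber A S x).card) ≤
          (((fiber A S y).filter (fun x => x k = b)).card : ℝ) / (fiber A S y).card := by
        intro b
        have e4 : ∀ x ∈ (fiber A S' y).filter (fun x => x k = b),
            ((fiber A (insert k S) x).card : ℝ) /
            ((fiber A (insert k S') x).card * (fiber A S x).card) =
            ((fiber A S y).filter (fun x => x k = b)).card /
            (((fiber A S' y).filter (fun x => x k = b)).card * (fiber A S y).card) := by
          intro x hx
          obtain ⟨hx1, hx2⟩ := mem_filter.1 hx
          obtain ⟨hx3, hx4⟩ := mem_fiber.1 hx1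
          have f1 : fiber A (insert k S) x = (fiber A S y).filter (fun x => x k = b) := by
            ext z
            simp only [mem_fiber, mem_filter, Finset.forall_mem_insert, hx2]
            have : (∀ i ∈ S, z i = x i) ↔ (∀ i ∈ S, z i = y i) :=
              forall₂_congr fun i hi => by rw [hx4 i (h hi)]
            rw [this]; tauto
          have f2 : fiber A (insert k S') x = (fiber A S' y).filter (fun x => x k = b) := by
            ext z
            simp only [mem_fiber, mem_filter, Finset.forall_mem_insert, hx2]
            have : (∀ i ∈ S', z i = x i) ↔ (∀ i ∈ S', z i = y i) :=
              forall₂_congr fun i hi => by rw [hx4 i hi]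
            rw [this]; tauto
          rw [f1, f2, fiber_congr (fun i hi => hx4 i (h hi))]
        rw [Finset.sum_congr rfl e4, Finset.sum_const, nsmul_eq_mul]
        rcases Nat.eq_zero_or_pos ((fiber A S' y).filter (fun x => x k = b)).card with h0 | h0
        · rw [h0]; simp; positivity
        · apply le_of_eq
          have : (0 : ℝ) < ((fiber A S' y).filter (fun x => x k = b)).card := by exact_mod_cast h0
          field_simp
      have e5 := Finset.sum_fiberwise (fiber A S' y) (fun x => x k)
        (fun x => ((fiber A (insert k S) x).card : ℝ) /
            ((fiber A (insert k S') x).card * (fiber A S x).card))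
      have e6 := Finset.card_eq_sum_card_fiberwise (s := fiber A S y) (t := Finset.univ)
        (f := fun x => x k) (fun _ _ => by simp)
      rw [← e5]
      refine (Finset.sum_le_sum fun b _ => e3 b).trans ?_
      rw [← Finset.sum_div, ← Nat.cast_sum, ← e6, div_self hy'.ne']
    refine (Finset.sum_le_sum e2).trans ?_
    simp
  have : ∑ x ∈ A, Real.logb 2 (t x) ≤ 0 := by
    have : ∑ x ∈ A, Real.logb 2 (t x) ≤ ∑ x ∈ A, (t x - 1) / Real.log 2 := by
      refine Finset.sum_le_sum fun x hx => logb_two_le _ ?_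
      have h1 := fiber_card_pos (R := S) hx
      have h2 := fiber_card_pos (R := S') hx
      have h3 := fiber_card_pos (R := insert k S) hx
      have h4 := fiber_card_pos (R := insert k S') hx
      rw [ht]; positivity
    refine this.trans ?_
    rw [← Finset.sum_div, Finset.sum_sub_distrib]
    simp only [sum_const, nsmul_eq_mul, mul_one]
    exact div_nonpos_of_nonpos_of_nonneg (by linarith) h2.le
  have e : ∑ x ∈ A, Real.logb 2 (t x) = fiberEntropy A S' + fiberEntropy A (insert k S)
      - fiberEntropy A (insert k S') - fiberEntropy A S := by
    simp only [fiberEntropy, ← Finset.sum_add_distrib, ← Finset.sum_sub_distrib]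
    refine Finset.sum_congr rfl fun x hx => ?_
    have h1 := (fiber_card_pos (R := S) hx).ne'
    have h2 := (fiber_card_pos (R := S') hx).ne'
    have h3 := (fiber_card_pos (R := insert k S) hx).ne'
    have h4 := (fiber_card_pos (R := insert k S') hx).ne'
    rw [ht]
    simp only
    rw [Real.logb_div (by positivity) (by positivity), Real.logb_mul h2 h3, Real.logb_mul h4 h1]
    ring
  linarith

/-- The entropy of the coordinates in `T` given those in `R` is at least the sum of the
entropies of the single coordinates given all others. -/
lemma sum_fiberEntropy_erase_le (A : Finset (ι → Bool)) {R T U : Finset ι} (hRT : Disjoint R T)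
    (hU : R ∪ T ⊆ U) :
    ∑ k ∈ T, (fiberEntropy A (U.erase k) - fiberEntropy A U) ≤
      fiberEntropy A R - fiberEntropy A (R ∪ T) := by
  induction T using Finset.induction_on with
  | empty => simp
  | insert i T hi ih =>
    rw [Finset.sum_insert hi]
    have hd : Disjoint R T := hRT.mono_right (Finset.subset_insert _ _)
    have hiR : i ∉ R := fun h => Finset.disjoint_left.1 hRT h (Finset.mem_insert_self _ _)
    have hiU : i ∈ U := hU (by simp)
    have h1 := ih hd (fun j hj => hU (by
      simp only [mem_union, mem_insert] at hj ⊢; tauto))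
    have hsub : R ∪ T ⊆ U.erase i := by
      intro j hj
      refine Finset.mem_erase.2 ⟨?_, hU ?_⟩
      · rintro rfl
        simp only [mem_union] at hj; tauto
      · simp only [mem_union, mem_insert] at hj ⊢; tauto
    have h2 := fiberEntropy_submodular A hsub i
    rw [Finset.insert_erase hiU] at h2
    have h3 : R ∪ insert i T = insert i (R ∪ T) := by
      ext; simp
    rw [h3]
    linarith

lemma fiberEntropy_univ (A : Finset (ι → Bool)) : fiberEntropy A univ = 0 := by
  refine Finset.sum_eq_zero fun x hx => ?_
  have : fiber A univ x = {x} := by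
    ext y
    simp only [mem_fiber, mem_univ, forall_const, mem_singleton]
    exact ⟨fun h => funext h.2, fun h => by subst h; exact ⟨hx, fun _ => rfl⟩⟩
  simp [this]

lemma fiberEntropy_empty (A : Finset (ι → Bool)) :
    fiberEntropy A ∅ = A.card * Real.logb 2 A.card := by
  simp [fiberEntropy, fiber_empty]

lemma fiberEntropy_erase_univ (A : Finset (ι → Bool)) (k : ι) :
    fiberEntropy A (univ.erase k) = inner A k := by
  rw [inner, Finset.card_filter, Nat.cast_sum]
  refine Finset.sum_congr rfl fun x hx => ?_
  have h : ∀ y, y ∈ fiber A (univ.erase k) x ↔ y ∈ A ∧ (y = x ∨ y = flipAt k x) := by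
    intro y
    rw [mem_fiber]
    refine and_congr_right fun _ => ?_
    constructor
    · intro h
      by_cases hk : y k = x k
      · left
        ext1 i
        by_cases hi : i = k
        · rw [hi, hk]
        · exact h i (by simp [hi])
      · right
        ext1 i
        by_cases hi : i = k
        · rw [hi, flipAt_same]
          revert hk; cases y k <;> cases x k <;> simp
        · rw [flipAt_of_ne hi]; exact h i (by simp [hi])
    · rintro (rfl | rfl) i hi
      · rfl
      · exact flipAt_of_ne (by simpa using hi) x
  by_cases hf : flipAt k x ∈ A
  · have : fiber A (univ.erase k) x = {x, flipAt k x} := by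
      ext y; rw [h]; simp only [mem_insert, mem_singleton]
      exact ⟨fun h => h.2, fun h => ⟨by rcases h with rfl | rfl <;> assumption, h⟩⟩
    rw [this, Finset.card_pair (flipAt_ne k x).symm]
    simp [hf]
  · have : fiber A (univ.erase k) x = {x} := by
      ext y; rw [h]; simp only [mem_singleton]
      constructor
      · rintro ⟨h1, h | h⟩
        · exact h
        · subst h; exact absurd h1 hf
      · rintro rfl; exact ⟨hx, Or.inl rfl⟩
    rw [this]
    simp [hf]

/-- Edge isoperimetry in the fibers over the coordinates in `R`. -/
lemma sum_inner_compl_le (A : Finset (ι → Bool)) (R : Finset ι) :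
    ∑ k ∈ Rᶜ, (inner A k : ℝ) ≤ fiberEntropy A R := by
  have := sum_fiberEntropy_erase_le A (R := R) (T := Rᶜ) (U := univ)
    disjoint_compl_right (Finset.subset_univ _)
  simpa [fiberEntropy_univ, fiberEntropy_erase_univ] using this

lemma excess_nonneg (A : Finset (ι → Bool)) : 0 ≤ excess A := by
  have := sum_inner_compl_le A ∅
  rw [fiberEntropy_empty] at this
  simp only [compl_empty] at this
  rw [excess]; linarith

/-- The mutual information of the coordinates inside and outside `R` is at most the excess. -/
lemma mutual_information_le (A : Finset (ι → Bool)) (R : Finset ι) :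
    A.card * Real.logb 2 A.card - fiberEntropy A R - fiberEntropy A Rᶜ ≤ excess A := by
  have h1 := sum_inner_compl_le A R
  have h2 := sum_inner_compl_le A Rᶜ
  rw [compl_compl] at h2
  have h3 := Finset.sum_add_sum_compl R (fun k => (inner A k : ℝ))
  rw [excess]; linarith

/-- The entropy of the coordinate `k ∈ R` given the other coordinates in `R` is, in total over
`k`, not much larger than its entropy given all other coordinates. -/
lemma sum_slack_le (A : Finset (ι → Bool)) (R : Finset ι) :
    ∑ k ∈ R, (fiberEntropy A (R.erase k) - fiberEntropy A R - inner A k) ≤ excess A := by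
  have h1 := sum_fiberEntropy_erase_le A (R := ∅) (T := R) (U := R) (by simp) (by simp)
  rw [fiberEntropy_empty] at h1
  simp only [Finset.empty_union] at h1
  have h2 := sum_inner_compl_le A R
  have h3 := Finset.sum_add_sum_compl R (fun k => (inner A k : ℝ))
  rw [Finset.sum_sub_distrib, excess]
  linarith

/-- The coordinate `k ∉ R` is, on average over `R` and in total over `k`, predicted by the
coordinates in `R` almost as well as by all other coordinates. -/
lemma sum_powerset_slack_le (A : Finset (ι → Bool)) :
    ∑ R : Finset ι, ∑ k ∈ Rᶜ, (fiberEntropy A R - fiberEntropy A (insert k R) - inner A k) ≤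
      2 ^ Fintype.card ι * excess A := by
  have h1 : ∑ R : Finset ι, ∑ k ∈ Rᶜ,
        (fiberEntropy A R - fiberEntropy A (insert k R) - inner A k) =
      ∑ R : Finset ι, ∑ k ∈ R, (fiberEntropy A (R.erase k) - fiberEntropy A R - inner A k) := by
    rw [Finset.sum_sigma', Finset.sum_sigma']
    refine Finset.sum_bij' (fun p _ => ⟨insert p.2 p.1, p.2⟩) (fun p _ => ⟨p.1.erase p.2, p.2⟩)
      ?_ ?_ ?_ ?_ ?_
    · rintro ⟨R, k⟩ h; simp
    · rintro ⟨R, k⟩ h; simp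
    · rintro ⟨R, k⟩ h
      have : k ∉ R := by simpa using h
      simp [this]
    · rintro ⟨R, k⟩ h
      have : k ∈ R := by simpa using h
      simp [Finset.insert_erase this]
    · rintro ⟨R, k⟩ h
      have : k ∉ R := by simpa using h
      simp [this]
  rw [h1]
  refine (Finset.sum_le_sum fun R _ => sum_slack_le A R).trans ?_
  rw [Finset.sum_const, card_univ, Fintype.card_finset]
  simp

end Entropy

/-! ### The loss of entropy at a split -/

/-- The entropy gained by splitting a set into parts of sizes `a` and `b`, multiplied by the
size of the set. -/
noncomputable def splitEntropy (a b : ℝ) : ℝ :=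
  (a + b) * Real.logb 2 (a + b) - a * Real.logb 2 a - b * Real.logb 2 b

/-- Concavity of the binary entropy on `[0, 1/4]` and `[1/4, 1/2]`, with `3 ^ 3 ≤ 2 ^ 5` for its
value at `1/4`. -/
lemma binEntropy_ge {q : ℝ} (h0 : 0 ≤ q) (h1 : q ≤ 1 / 2) :
    Real.log 2 * (3 * q - 2 * q ^ 2) ≤ Real.binEntropy q := by
  have hl : 0 < Real.log 2 := Real.log_pos (by norm_num)
  have hc := Real.strictConcave_binEntropy.concaveOn
  have hh : Real.binEntropy (1 / 2) = Real.log 2 := by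
    rw [one_div]; exact Real.binEntropy_two_inv
  have hq : 3 / 4 * Real.log 2 ≤ Real.binEntropy (1 / 4) := by
    have h3 : 3 * Real.log 3 ≤ 5 * Real.log 2 := by
      have := Real.log_le_log (by norm_num) (show (3 : ℝ) ^ 3 ≤ 2 ^ 5 by norm_num)
      simpa [Real.log_pow] using this
    have h4 : Real.log 4 = 2 * Real.log 2 := by
      rw [show (4 : ℝ) = 2 ^ 2 by norm_num, Real.log_pow]; norm_num
    rw [Real.binEntropy]
    have e1 : Real.log ((1 / 4 : ℝ)⁻¹) = 2 * Real.log 2 := by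
      rw [← h4]; norm_num
    have e2 : Real.log ((1 - 1 / 4 : ℝ)⁻¹) = 2 * Real.log 2 - Real.log 3 := by
      rw [← h4, ← Real.log_div (by norm_num) (by norm_num)]; norm_num
    rw [e1, e2]; linarith
  rcases le_total q (1 / 4) with h | h
  · have := hc.2 (show (0 : ℝ) ∈ Set.Icc 0 1 by norm_num)
      (show (1 / 4 : ℝ) ∈ Set.Icc 0 1 by norm_num) (show 0 ≤ 1 - 4 * q by linarith)
      (show 0 ≤ 4 * q by linarith) (by ring)
    simp only [smul_eq_mul, Real.binEntropy_zero] at this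
    rw [show (1 - 4 * q) * 0 + 4 * q * (1 / 4) = q by ring] at this
    nlinarith [mul_nonneg hl.le (sq_nonneg q)]
  · have := hc.2 (show (1 / 4 : ℝ) ∈ Set.Icc 0 1 by norm_num)
      (show (1 / 2 : ℝ) ∈ Set.Icc 0 1 by norm_num) (show 0 ≤ 2 - 4 * q by linarith)
      (show 0 ≤ 4 * q - 1 by linarith) (by ring)
    simp only [smul_eq_mul] at this
    rw [show (2 - 4 * q) * (1 / 4) + (4 * q - 1) * (1 / 2) = q by ring, hh] at this
    nlinarith [mul_nonneg hl.le (sq_nonneg (q - 1 / 2))]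

lemma splitEntropy_ge {a b : ℝ} (ha : 0 ≤ a) (hab : a ≤ b) (hb : 0 < b) :
    2 * a + a * (b - a) / (a + b) ≤ splitEntropy a b := by
  have hl : 0 < Real.log 2 := Real.log_pos (by norm_num)
  have hN : 0 < a + b := by linarith
  have h := binEntropy_ge (q := a / (a + b)) (by positivity)
    (by rw [div_le_div_iff₀ hN (by norm_num)]; linarith)
  have e : splitEntropy a b = (a + b) * Real.binEntropy (a / (a + b)) / Real.log 2 := by
    have e1 : 1 - a / (a + b) = b / (a + b) := by field_simp; ring
    rw [Real.binEntropy, e1, splitEntropy]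
    simp only [Real.logb]
    rw [Real.log_inv, Real.log_inv, Real.log_div hb.ne' hN.ne']
    rcases ha.eq_or_lt with rfl | ha
    · simp
    · rw [Real.log_div ha.ne' hN.ne']
      field_simp
      ring
  rw [e, le_div_iff₀ hl]
  have := mul_le_mul_of_nonneg_left h hN.le
  refine le_trans (le_of_eq ?_) this
  field_simp
  ring

/-- The loss in the edge-isoperimetric inequality at a split into parts of sizes `a ≤ b` with
`e / 2` edges between them. -/
lemma splitEntropy_sub_ge {a b e : ℝ} (ha : 0 ≤ a) (hab : a ≤ b) (hb : 0 < b) (he : e ≤ 2 * a) :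
    (a + b - e) * a / (a + b) ≤ splitEntropy a b - e := by
  have hN : 0 < a + b := by linarith
  have h := splitEntropy_ge ha hab hb
  have : (a + b - e) * a / (a + b) ≤ 2 * a + a * (b - a) / (a + b) - e := by
    have h2 : 2 * a + a * (b - a) / (a + b) - e - (a + b - e) * a / (a + b) =
      (2 * a - e) * b / (a + b) := by
      field_simp; ring
    have : 0 ≤ (2 * a - e) * b / (a + b) := by
      apply div_nonneg (mul_nonneg (by linarith) hb.le) hN.le
    linarith
  linarith

/-- A very unbalanced split has a loss much larger than its smaller part. -/
lemma splitEntropy_ge_of_unbalanced {a b K : ℝ} (ha : 0 ≤ a) (hb : 0 < b)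
    (hK : a ≤ (2 : ℝ) ^ (-(K + 2)) * (a + b)) :
    K * a + 2 * a ≤ splitEntropy a b := by
  rcases ha.eq_or_lt with rfl | ha
  · simp [splitEntropy]
  have hN : 0 < a + b := by linarith
  have h1 : Real.logb 2 a ≤ -(K + 2) + Real.logb 2 (a + b) := by
    have := Real.logb_le_logb_of_le (b := 2) (by norm_num) ha hK
    rwa [Real.logb_mul (by positivity) hN.ne', Real.logb_rpow (by norm_num) (by norm_num)] at this
  have h2 : Real.logb 2 b ≤ Real.logb 2 (a + b) :=
    Real.logb_le_logb_of_le (by norm_num) hb (by linarith)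
  rw [splitEntropy]
  nlinarith [mul_le_mul_of_nonneg_left h1 ha.le, mul_le_mul_of_nonneg_left h2 hb.le]

/-! ### Splitting along a coordinate -/

section Half

variable {ι : Type*}

/-- The points of `A` with coordinate `i` equal to `b`. -/
def half (A : Finset (ι → Bool)) (i : ι) (b : Bool) : Finset (ι → Bool) :=
  A.filter fun x => x i = b

lemma mem_half {A : Finset (ι → Bool)} {i : ι} {b : Bool} {x : ι → Bool} :
    x ∈ half A i b ↔ x ∈ A ∧ x i = b := by simp [half]

lemma half_subset (A : Finset (ι → Bool)) (i : ι) (b : Bool) : half A i b ⊆ A :=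
  Finset.filter_subset _ _

lemma sum_half (A : Finset (ι → Bool)) (i : ι) (b : Bool) (g : (ι → Bool) → ℝ) :
    ∑ x ∈ A, g x = ∑ x ∈ half A i b, g x + ∑ x ∈ half A i (!b), g x := by
  rw [← Finset.sum_filter_add_sum_filter_not A (fun x => x i = b), half, half]
  congr 2
  ext x
  cases b <;> simp

lemma card_half (A : Finset (ι → Bool)) (i : ι) (b : Bool) :
    (A.card : ℝ) = (half A i b).card + (half A i (!b)).card := by
  have := sum_half A i b (fun _ => 1)
  simpa using this

lemma exists_half_le (A : Finset (ι → Bool)) (i : ι) :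
    ∃ b, (half A i b).card ≤ (half A i (!b)).card := by
  rcases le_total (half A i true).card (half A i false).card with h | h
  · exact ⟨true, h⟩
  · exact ⟨false, h⟩

end Half

section Split

variable {ι : Type*} [Fintype ι] [DecidableEq ι]

/-- The number of neighbours of `x` in `A`. -/
def deg (A : Finset (ι → Bool)) (x : ι → Bool) : ℕ :=
  (univ.filter fun k => flipAt k x ∈ A).card

lemma inner_eq_sum (A : Finset (ι → Bool)) (k : ι) :
    (inner A k : ℝ) = ∑ x ∈ A, if flipAt k x ∈ A then (1 : ℝ) else 0 := by
  simp [inner]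

lemma bdry_eq_sum (A : Finset (ι → Bool)) (k : ι) :
    (bdry A k : ℝ) = ∑ x ∈ A, if flipAt k x ∉ A then (1 : ℝ) else 0 := by
  rw [bdry, Finset.card_filter]
  push_cast
  rfl

lemma inner_half_self (A : Finset (ι → Bool)) (i : ι) (b : Bool) : inner (half A i b) i = 0 := by
  rw [inner, Finset.card_eq_zero, Finset.filter_eq_empty_iff]
  intro x hx h
  have h1 := (mem_half.1 hx).2
  have h2 := (mem_half.1 h).2
  rw [flipAt_same, h1] at h2
  cases b <;> simp at h2

lemma inner_half_of_ne (A : Finset (ι → Bool)) {i k : ι} (h : i ≠ k) (b : Bool) :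
    (inner A k : ℝ) = inner (half A i b) k + inner (half A i (!b)) k := by
  have : ∀ c, (inner (half A i c) k : ℝ) =
      ∑ x ∈ half A i c, if flipAt k x ∈ A then (1 : ℝ) else 0 := by
    intro c
    rw [inner_eq_sum]
    refine Finset.sum_congr rfl fun x hx => ?_
    simp only [mem_half, flipAt_of_ne h, (mem_half.1 hx).2, and_true]
  rw [this, this, inner_eq_sum, sum_half A i b]

/-- The points of one half whose neighbour in direction `i` is in the other half. -/
def matched (A : Finset (ι → Bool)) (i : ι) (b : Bool) : Finset (ι → Bool) :=
  (half A i b).filter fun x => flipAt i x ∈ A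

lemma matched_card_comm (A : Finset (ι → Bool)) (i : ι) (b : Bool) :
    (matched A i b).card = (matched A i (!b)).card := by
  refine Finset.card_bij' (fun x _ => flipAt i x) (fun x _ => flipAt i x) ?_ ?_
    (fun x _ => flipAt_flipAt i x) (fun x _ => flipAt_flipAt i x)
  · intro x hx
    simp only [matched, mem_filter, mem_half, flipAt_flipAt, flipAt_same] at hx ⊢
    exact ⟨⟨hx.2, by rw [hx.1.2]⟩, hx.1.1⟩
  · intro x hx
    simp only [matched, mem_filter, mem_half, flipAt_flipAt, flipAt_same] at hx ⊢
    exact ⟨⟨hx.2, by rw [hx.1.2]; simp⟩, hx.1.1⟩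

lemma inner_eq_two_mul (A : Finset (ι → Bool)) (i : ι) (b : Bool) :
    (inner A i : ℝ) = 2 * (matched A i b).card := by
  have h : ∀ c, ∑ x ∈ half A i c, (if flipAt i x ∈ A then (1 : ℝ) else 0) =
      (matched A i c).card := by
    intro c; simp [matched]
  rw [inner_eq_sum, sum_half A i b, h, h, ← matched_card_comm A i b]
  ring

lemma inner_le_two_mul (A : Finset (ι → Bool)) (i : ι) (b : Bool) :
    (inner A i : ℝ) ≤ 2 * (half A i b).card := by
  rw [inner_eq_two_mul A i b]
  have : (matched A i b).card ≤ (half A i b).card := Finset.card_filter_le _ _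
  have : ((matched A i b).card : ℝ) ≤ (half A i b).card := by exact_mod_cast this
  linarith

lemma bdry_eq (A : Finset (ι → Bool)) (i : ι) : (bdry A i : ℝ) = A.card - inner A i := by
  rw [← inner_add_bdry A i]; push_cast; ring

lemma excess_split (A : Finset (ι → Bool)) (i : ι) (b : Bool) :
    excess A = excess (half A i b) + excess (half A i (!b)) +
      (splitEntropy (half A i b).card (half A i (!b)).card - inner A i) := by
  have h : ∑ k, (inner A k : ℝ) = ∑ k, (inner (half A i b) k : ℝ) +
      ∑ k, (inner (half A i (!b)) k : ℝ) + inner A i := by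
    rw [← Finset.add_sum_erase univ _ (mem_univ i),
      ← Finset.add_sum_erase univ (fun k => (inner (half A i b) k : ℝ)) (mem_univ i),
      ← Finset.add_sum_erase univ (fun k => (inner (half A i (!b)) k : ℝ)) (mem_univ i),
      inner_half_self, inner_half_self]
    have : ∑ k ∈ univ.erase i, (inner A k : ℝ) = ∑ k ∈ univ.erase i,
        ((inner (half A i b) k : ℝ) + inner (half A i (!b)) k) :=
      Finset.sum_congr rfl fun k hk => inner_half_of_ne A (Finset.ne_of_mem_erase hk).symm b
    rw [this, Finset.sum_add_distrib]
    push_cast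
    ring
  rw [excess, excess, excess, h, splitEntropy, card_half A i b]
  ring

/-- The decrease of the excess at a split is at least the boundary in that direction times the
proportion of the smaller half. -/
lemma excess_split_ge (A : Finset (ι → Bool)) (i : ι) (b : Bool)
    (h : (half A i b).card ≤ (half A i (!b)).card) :
    (bdry A i : ℝ) * (half A i b).card / A.card ≤
      splitEntropy (half A i b).card (half A i (!b)).card - inner A i := by
  rcases Nat.eq_zero_or_pos (half A i (!b)).card with h0 | h0
  · have h1 : (half A i b).card = 0 := by omega
    have h2 := inner_le_two_mul A i b
    rw [h0, h1]
    rw [h1] at h2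
    simp [splitEntropy] at h2 ⊢
    simp [h2]
  · have := splitEntropy_sub_ge (a := (half A i b).card) (b := (half A i (!b)).card)
      (e := inner A i) (by positivity) (by exact_mod_cast h) (by exact_mod_cast h0)
      (inner_le_two_mul A i b)
    rwa [← card_half, ← bdry_eq] at this

lemma deg_half (A : Finset (ι → Bool)) (i : ι) (b : Bool) {x : ι → Bool} (hx : x ∈ half A i b) :
    (deg A x : ℝ) = deg (half A i b) x + if flipAt i x ∈ A then (1 : ℝ) else 0 := by
  have h : ∀ B : Finset (ι → Bool), (deg B x : ℝ) = (if flipAt i x ∈ B then (1 : ℝ) else 0) +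
      ∑ k ∈ univ.erase i, if flipAt k x ∈ B then (1 : ℝ) else 0 := by
    intro B
    rw [Finset.add_sum_erase univ (fun k => if flipAt k x ∈ B then (1 : ℝ) else 0) (mem_univ i)]
    simp [deg]
  have hb := (mem_half.1 hx).2
  rw [h A, h (half A i b), if_neg (c := flipAt i x ∈ half A i b)]
  · rw [zero_add, add_comm]
    congr 1
    refine Finset.sum_congr rfl fun k hk => ?_
    have hk' : i ≠ k := (Finset.ne_of_mem_erase hk).symm
    simp only [mem_half, flipAt_of_ne hk', hb, and_true]
  · rw [mem_half, flipAt_same, hb]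
    cases b <;> simp

/-- Degrees in `A` rarely exceed `log |A|`, the largest possible average degree, by much when the
excess is small. The proof splits `A` repeatedly: only the points of the larger half that have a
neighbour in the smaller half contribute, and the loss of entropy at the split pays for them. -/
lemma sum_deg_sub_logb_le (A : Finset (ι → Bool)) :
    ∑ x ∈ A, max 0 ((deg A x : ℝ) - Real.logb 2 A.card) ≤ 2 * excess A := by
  induction h : A.card using Nat.strong_induction_on generalizing A with
  | _ n ih =>
  subst h
  rcases Nat.lt_or_ge 1 A.card with h1 | h1
  · obtain ⟨x, hx, y, hy, hxy⟩ := Finset.one_lt_card.1 h1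
    obtain ⟨i, hi⟩ := Function.ne_iff.1 hxy
    have hpos : ∀ c, 0 < (half A i c).card := by
      intro c
      rw [Finset.card_pos]
      by_cases hc : x i = c
      · exact ⟨x, mem_half.2 ⟨hx, hc⟩⟩
      · exact ⟨y, mem_half.2 ⟨hy, by revert hi hc; cases x i <;> cases y i <;> cases c <;> simp⟩⟩
    have hlt : ∀ c, (half A i c).card < A.card := by
      intro c
      have h2 := card_half A i c
      have h3 : (0 : ℝ) < (half A i (!c)).card := by exact_mod_cast hpos (!c)
      have : ((half A i c).card : ℝ) < A.card := by linarith
      exact_mod_cast this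
    obtain ⟨b, hb⟩ := exists_half_le A i
    have hAN := card_half A i b
    set a : ℝ := ((half A i b).card : ℝ) with ha
    set d : ℝ := ((half A i (!b)).card : ℝ) with hd
    have hapos : 0 < a := Nat.cast_pos.2 (hpos b)
    have hdpos : 0 < d := Nat.cast_pos.2 (hpos (!b))
    have hN : (0 : ℝ) < A.card := by linarith
    have had : a ≤ d := Nat.cast_le.2 hb
    have hl : 1 / 2 ≤ Real.log 2 := by have := Real.log_two_gt_d9; linarith
    -- the increments in the smaller and in the larger half
    have step : ∀ c, ∑ x ∈ half A i c, max 0 ((deg A x : ℝ) - Real.logb 2 A.card) ≤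
        2 * excess (half A i c) + (matched A i c).card *
          max 0 (1 + Real.logb 2 ((half A i c).card / A.card)) := by
      intro c
      have hcpos : (0 : ℝ) < (half A i c).card := by exact_mod_cast hpos c
      refine le_trans ?_ (add_le_add_left (ih _ (hlt c) (half A i c) rfl) _)
      have e : ((matched A i c).card : ℝ) *
          max 0 (1 + Real.logb 2 ((half A i c).card / A.card)) =
          ∑ x ∈ half A i c, (if flipAt i x ∈ A then (1 : ℝ) else 0) *
            max 0 (1 + Real.logb 2 ((half A i c).card / A.card)) := by
        rw [← Finset.sum_mul]
        simp [matched]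
      rw [e, ← Finset.sum_add_distrib]
      refine Finset.sum_le_sum fun x hx => ?_
      rw [deg_half A i c hx, Real.logb_div hcpos.ne' hN.ne']
      have hle : Real.logb 2 (half A i c).card ≤ Real.logb 2 A.card :=
        Real.logb_le_logb_of_le (by norm_num) hcpos (by exact_mod_cast (hlt c).le)
      have m1 := le_max_left 0 ((deg (half A i c) x : ℝ) - Real.logb 2 (half A i c).card)
      have m2 := le_max_right 0 ((deg (half A i c) x : ℝ) - Real.logb 2 (half A i c).card)
      have m3 := le_max_left 0 (1 + (Real.logb 2 (half A i c).card - Real.logb 2 A.card))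
      have m4 := le_max_right 0 (1 + (Real.logb 2 (half A i c).card - Real.logb 2 A.card))
      split_ifs
      · apply max_le <;> linarith
      · apply max_le <;> linarith
    have hsmall : max 0 (1 + Real.logb 2 (a / A.card)) = 0 := by
      apply max_eq_left
      have : Real.logb 2 (a / A.card) ≤ Real.logb 2 (2⁻¹) := by
        apply Real.logb_le_logb_of_le (by norm_num) (by positivity)
        rw [div_le_iff₀ hN]; linarith
      rw [Real.logb_inv, Real.logb_self_eq_one (by norm_num)] at this
      linarith
    have hlarge : max 0 (1 + Real.logb 2 (d / A.card)) ≤ 2 * ((d - a) / A.card) := by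
      have h0 : 0 ≤ (d - a) / A.card := div_nonneg (by linarith) hN.le
      apply max_le (by linarith)
      have h2 := logb_two_le (2 * (d / A.card)) (by positivity)
      rw [Real.logb_mul (by norm_num) (by positivity), Real.logb_self_eq_one (by norm_num)] at h2
      refine h2.trans ?_
      have : 2 * (d / (A.card : ℝ)) - 1 = (d - a) / A.card := by
        field_simp; linarith
      rw [this, div_le_iff₀ (by linarith)]
      nlinarith
    have hm : ((matched A i (!b)).card : ℝ) ≤ a := by
      rw [← matched_card_comm]
      exact Nat.cast_le.2 (Finset.card_filter_le _ _)
    have hge := excess_split_ge A i b hb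
    have hsp := excess_split A i b
    have hB : d - a ≤ bdry A i := by
      have := inner_le_two_mul A i b
      rw [bdry_eq]; linarith
    have s1 := step b
    have s2 := step (!b)
    rw [← ha, hsmall, mul_zero, add_zero] at s1
    rw [← hd] at s2
    have h5 : ((matched A i (!b)).card : ℝ) * max 0 (1 + Real.logb 2 (d / A.card)) ≤
        2 * ((bdry A i : ℝ) * a / A.card) := by
      calc _ ≤ a * (2 * ((d - a) / A.card)) :=
            mul_le_mul hm hlarge (le_max_left _ _) hapos.le
        _ = 2 * ((d - a) * a / A.card) := by ring
        _ ≤ _ := by gcongr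
    rw [sum_half A i b]
    linarith
  · have h0 := excess_nonneg A
    refine le_trans (le_of_eq (Finset.sum_eq_zero fun x hx => ?_)) (by linarith)
    have hA : A = {x} := by
      rw [Finset.eq_singleton_iff_unique_mem]
      exact ⟨hx, fun y hy => Finset.card_le_one.1 h1 y hy x hx⟩
    have hd : deg A x = 0 := by
      rw [deg, Finset.card_eq_zero, Finset.filter_eq_empty_iff]
      intro k _ hk
      rw [hA, mem_singleton] at hk
      exact flipAt_ne k x hk
    rw [hd, hA]
    simp

end Split

/-! ### Small sets with small boundary in every direction -/

section Prediction

variable {ι : Type*} [Fintype ι] [DecidableEq ι]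

/-- The coordinate `k` is predicted at `x` by the coordinates in `R`: among the points of `A`
that agree with `x` on `R`, one of the two values of the coordinate `k` is taken by at most a
quarter. -/
def Predicted (A : Finset (ι → Bool)) (R : Finset ι) (k : ι) (x : ι → Bool) : Prop :=
  ∃ b, 4 * (half (fiber A R x) k b).card ≤ (fiber A R x).card

lemma predicted_congr {A : Finset (ι → Bool)} {R : Finset ι} {k : ι} {x y : ι → Bool}
    (h : ∀ i ∈ R, y i = x i) : Predicted A R k y ↔ Predicted A R k x := by
  rw [Predicted, Predicted, fiber_congr h]

lemma flipAt_mem_fiber {A : Finset (ι → Bool)} {R : Finset ι} {k : ι} (hk : k ∉ R)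
    {x y : ι → Bool} (hy : y ∈ fiber A R x) :
    flipAt k y ∈ fiber A R x ↔ flipAt k y ∈ A := by
  rw [mem_fiber, and_iff_left]
  intro i hi
  rw [flipAt_of_ne (by rintro rfl; exact hk hi)]
  exact (mem_fiber.1 hy).2 i hi

lemma sum_fiber_inner (A : Finset (ι → Bool)) {R : Finset ι} {k : ι} (hk : k ∉ R)
    (x : ι → Bool) :
    ∑ y ∈ fiber A R x, (if flipAt k y ∈ A then (1 : ℝ) else 0) = inner (fiber A R x) k := by
  rw [inner_eq_sum]
  exact Finset.sum_congr rfl fun y hy => by simp only [flipAt_mem_fiber hk hy]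

lemma sum_fiber_bdry (A : Finset (ι → Bool)) {R : Finset ι} {k : ι} (hk : k ∉ R)
    (x : ι → Bool) :
    ∑ y ∈ fiber A R x, (if flipAt k y ∉ A then (1 : ℝ) else 0) = bdry (fiber A R x) k := by
  rw [bdry_eq_sum]
  exact Finset.sum_congr rfl fun y hy => by simp only [flipAt_mem_fiber hk hy]

lemma fiber_insert {A : Finset (ι → Bool)} {R : Finset ι} {k : ι} {x y : ι → Bool}
    (hy : y ∈ fiber A R x) : fiber A (insert k R) y = half (fiber A R x) k (y k) := by
  ext z
  rw [mem_half, mem_fiber, mem_fiber, Finset.forall_mem_insert]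
  have : (∀ i ∈ R, z i = y i) ↔ (∀ i ∈ R, z i = x i) :=
    forall₂_congr fun i hi => by rw [(mem_fiber.1 hy).2 i hi]
  rw [this]; tauto

lemma sum_fiber_logb (A : Finset (ι → Bool)) (R : Finset ι) (k : ι) (x : ι → Bool) (b : Bool) :
    ∑ y ∈ fiber A R x, (Real.logb 2 (fiber A R y).card - Real.logb 2 (fiber A (insert k R) y).card)
      = splitEntropy (half (fiber A R x) k b).card (half (fiber A R x) k (!b)).card := by
  have h : ∀ c, ∑ y ∈ half (fiber A R x) k c,
      (Real.logb 2 (fiber A R y).card - Real.logb 2 (fiber A (insert k R) y).card) =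
      (half (fiber A R x) k c).card *
        (Real.logb 2 (fiber A R x).card - Real.logb 2 (half (fiber A R x) k c).card) := by
    intro c
    rw [← nsmul_eq_mul, ← Finset.sum_const]
    refine Finset.sum_congr rfl fun y hy => ?_
    obtain ⟨hy1, hy2⟩ := mem_half.1 hy
    rw [fiber_insert hy1, fiber_eq_of_mem hy1, hy2]
  rw [sum_half _ k b, h, h, splitEntropy, ← card_half]
  rw [card_half (fiber A R x) k b]
  ring

open Classical in
/-- Boundary edges in a direction that is not predicted are paid for by the loss of entropy. -/
lemma card_unpredicted_le (A : Finset (ι → Bool)) {R : Finset ι} {k : ι} (hk : k ∉ R) :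
    ∑ y ∈ A, (if flipAt k y ∉ A ∧ ¬ Predicted A R k y then (1 : ℝ) else 0) ≤
      4 * (fiberEntropy A R - fiberEntropy A (insert k R) - inner A k) := by
  have e : 4 * (fiberEntropy A R - fiberEntropy A (insert k R) - inner A k) =
      ∑ y ∈ A, 4 * (Real.logb 2 (fiber A R y).card - Real.logb 2 (fiber A (insert k R) y).card -
        if flipAt k y ∈ A then (1 : ℝ) else 0) := by
    rw [fiberEntropy, fiberEntropy, inner_eq_sum, ← Finset.sum_sub_distrib,
      ← Finset.sum_sub_distrib, Finset.mul_sum]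
  rw [e, ← sum_fiber_average A R, ← sum_fiber_average A R (fun y => 4 * _)]
  refine Finset.sum_le_sum fun x hx => ?_
  apply div_le_div_of_nonneg_right _ (Nat.cast_nonneg _)
  obtain ⟨b, hb⟩ := exists_half_le (fiber A R x) k
  rw [← Finset.mul_sum, Finset.sum_sub_distrib, sum_fiber_logb A R k x b, sum_fiber_inner A hk]
  have h1 := excess_split_ge (fiber A R x) k b hb
  have h2 : (0 : ℝ) < (fiber A R x).card := fiber_card_pos hx
  have h4 : (0 : ℝ) ≤ bdry (fiber A R x) k := Nat.cast_nonneg _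
  by_cases hP : Predicted A R k x
  · rw [Finset.sum_eq_zero]
    · have : (0 : ℝ) ≤ bdry (fiber A R x) k * (half (fiber A R x) k b).card /
        (fiber A R x).card := by positivity
      linarith
    · intro y hy
      rw [if_neg]
      rw [predicted_congr (mem_fiber.1 hy).2]
      tauto
  · have h3 : ∑ y ∈ fiber A R x, (if flipAt k y ∉ A ∧ ¬ Predicted A R k y then (1 : ℝ) else 0) =
        bdry (fiber A R x) k := by
      rw [← sum_fiber_bdry A hk]
      refine Finset.sum_congr rfl fun y hy => ?_
      rw [predicted_congr (mem_fiber.1 hy).2]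
      simp only [hP, not_false_eq_true, and_true]
    rw [h3]
    have h5 : ((fiber A R x).card : ℝ) ≤ 4 * (half (fiber A R x) k b).card := by
      by_contra hlt
      push Not at hlt
      exact hP ⟨b, by exact_mod_cast hlt.le⟩
    have h6 : (bdry (fiber A R x) k : ℝ) ≤
        4 * (bdry (fiber A R x) k * (half (fiber A R x) k b).card / (fiber A R x).card) := by
      rw [mul_div_assoc', le_div_iff₀ h2]
      nlinarith
    linarith

open Classical in
/-- A direction is predicted at few points unless it has a large boundary. -/
lemma card_predicted_le (A : Finset (ι → Bool)) {R : Finset ι} {k : ι} (hk : k ∉ R) :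
    ((A.filter (Predicted A R k)).card : ℝ) ≤ 2 * bdry A k := by
  have e : ((A.filter (Predicted A R k)).card : ℝ) =
      ∑ y ∈ A, if Predicted A R k y then (1 : ℝ) else 0 := by simp
  rw [e, bdry_eq_sum, Finset.mul_sum, ← sum_fiber_average A R,
    ← sum_fiber_average A R (fun y => 2 * _)]
  refine Finset.sum_le_sum fun x hx => ?_
  apply div_le_div_of_nonneg_right _ (Nat.cast_nonneg _)
  rw [← Finset.mul_sum, sum_fiber_bdry A hk]
  by_cases hP : Predicted A R k x
  · obtain ⟨b, hb⟩ := hP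
    have h1 := inner_le_two_mul (fiber A R x) k b
    have h2 := bdry_eq (fiber A R x) k
    have h3 : (4 : ℝ) * (half (fiber A R x) k b).card ≤ (fiber A R x).card := by exact_mod_cast hb
    have h4 : ∑ y ∈ fiber A R x, (if Predicted A R k y then (1 : ℝ) else 0) ≤
        (fiber A R x).card := by
      rw [Finset.sum_boole]
      exact_mod_cast Finset.card_filter_le _ _
    linarith
  · rw [Finset.sum_eq_zero]
    · positivity
    · intro y hy
      rw [predicted_congr (mem_fiber.1 hy).2, if_neg hP]

/-- The number of pairs of points which, mixed along `R`, give a point of `Z`. -/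
lemma sum_fiber_mul_fiber_le (A Z Φ Ψ : Finset (ι → Bool)) (R : Finset ι)
    (h1 : ∀ z ∈ Z, fiber A R z ⊆ Φ) (h2 : ∀ z ∈ Z, fiber A Rᶜ z ⊆ Ψ) :
    ∑ z ∈ Z, ((fiber A R z).card : ℝ) * (fiber A Rᶜ z).card ≤ Φ.card * Ψ.card := by
  have : (Z.sigma fun z => fiber A R z ×ˢ fiber A Rᶜ z).card ≤ (Φ ×ˢ Ψ).card := by
    refine Finset.card_le_card_of_injOn (fun p => p.2) ?_ ?_
    · rintro ⟨z, x, y⟩ h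
      simp only [coe_sigma, Set.mem_sigma_iff, mem_coe, mem_product] at h
      simp only [coe_product, Set.mem_prod, mem_coe]
      exact ⟨h1 z h.1 h.2.1, h2 z h.1 h.2.2⟩
    · rintro ⟨z, x, y⟩ h ⟨z', x', y'⟩ h' e
      simp only [coe_sigma, Set.mem_sigma_iff, mem_coe, mem_product, mem_fiber] at h h'
      simp only [Prod.mk.injEq] at e
      obtain ⟨rfl, rfl⟩ := e
      have : z = z' := by
        ext1 i
        by_cases hi : i ∈ R
        · rw [← h.2.1.2 i hi, h'.2.1.2 i hi]
        · have hi : i ∈ Rᶜ := by simpa using hi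
          rw [← h.2.2.2 i hi, h'.2.2.2 i hi]
      rw [this]
  rw [Finset.card_sigma, Finset.card_product] at this
  simp only [Finset.card_product] at this
  exact_mod_cast this

/-- Jensen's inequality for the logarithm. -/
lemma sum_logb_le {α : Type*} (s : Finset α) (w : α → ℝ) {W : ℝ} (hw : ∀ x ∈ s, 0 < w x)
    (hW0 : 0 < W) (hW : ∑ x ∈ s, w x ≤ W) :
    ∑ x ∈ s, Real.logb 2 (w x) ≤ s.card * (Real.logb 2 W - Real.logb 2 s.card) := by
  rcases s.eq_empty_or_nonempty with rfl | hs
  · simp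
  have hc : (0 : ℝ) < s.card := by exact_mod_cast hs.card_pos
  have hl : 0 < Real.log 2 := Real.log_pos (by norm_num)
  have h1 : ∀ x ∈ s, Real.logb 2 (w x) ≤ (Real.logb 2 W - Real.logb 2 s.card) +
      (w x * (s.card / W) - 1) / Real.log 2 := by
    intro x hx
    have := logb_two_le (w x * (s.card / W)) (mul_pos (hw x hx) (by positivity))
    rw [Real.logb_mul (hw x hx).ne' (by positivity), Real.logb_div hc.ne' hW0.ne'] at this
    linarith
  refine (Finset.sum_le_sum h1).trans ?_
  rw [Finset.sum_add_distrib, Finset.sum_const, nsmul_eq_mul, ← Finset.sum_div,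
    Finset.sum_sub_distrib, ← Finset.sum_mul]
  have : (∑ x ∈ s, w x) * (s.card / W) ≤ s.card := by
    calc _ ≤ W * (s.card / W) := by gcongr
      _ = s.card := by field_simp
  have h3 : ((∑ x ∈ s, w x) * (s.card / W) - ∑ x ∈ s, (1 : ℝ)) / Real.log 2 ≤ 0 := by
    apply div_nonpos_of_nonpos_of_nonneg _ hl.le
    simp only [sum_const, nsmul_eq_mul, mul_one]
    linarith
  linarith

lemma splitEntropy_le {a b : ℝ} (ha : 0 ≤ a) (hb : 0 ≤ b) : splitEntropy a b ≤ a + b := by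
  have hl : 0 < Real.log 2 := Real.log_pos (by norm_num)
  rcases ha.eq_or_lt with rfl | ha
  · simp [splitEntropy, hb]
  rcases hb.eq_or_lt with rfl | hb
  · simp [splitEntropy, ha.le]
  have key : ∀ c, 0 < c → c * Real.logb 2 (a + b) - c * Real.logb 2 c ≤
      c + ((a + b) / 2 - c) / Real.log 2 := by
    intro c hc
    have h := logb_two_le ((a + b) / (2 * c)) (by positivity)
    rw [Real.logb_div (by positivity) (by positivity), Real.logb_mul (by norm_num) hc.ne',
      Real.logb_self_eq_one (by norm_num)] at h
    have := mul_le_mul_of_nonneg_left h hc.le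
    have e : c * (((a + b) / (2 * c) - 1) / Real.log 2) = ((a + b) / 2 - c) / Real.log 2 := by
      field_simp
    rw [e] at this
    linarith
  have h1 := key a ha
  have h2 := key b hb
  have e : ((a + b) / 2 - a) / Real.log 2 + ((a + b) / 2 - b) / Real.log 2 = 0 := by
    field_simp; ring
  rw [splitEntropy]
  linarith

/-- If the random mixture of two points of `A` along `R` has small probability of falling in a
large part `E` of `A`, then the excess is large. -/
lemma excess_ge_of_subset (A E : Finset (ι → Bool)) (hA : A.Nonempty) (hE : E ⊆ A) (R : Finset ι)
    {q : ℝ} (hq : 0 < q)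
    (hW : ∑ z ∈ E, ((fiber A R z).card : ℝ) * (fiber A Rᶜ z).card ≤ q * A.card ^ 2) :
    E.card * Real.logb 2 (1 / q) - A.card ≤ excess A := by
  have hN : (0 : ℝ) < A.card := by exact_mod_cast hA.card_pos
  have hpos : ∀ x ∈ A, 0 < ((fiber A R x).card : ℝ) * (fiber A Rᶜ x).card :=
    fun x hx => mul_pos (fiber_card_pos hx) (fiber_card_pos hx)
  have h1 := sum_logb_le E _ (fun x hx => hpos x (hE hx)) (by positivity) hW
  have h2 := sum_logb_le (A \ E) _ (W := A.card ^ 2)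
    (fun x hx => hpos x (Finset.sdiff_subset hx)) (by positivity) (by
      have := sum_fiber_mul_fiber_le A (A \ E) A A R (fun z _ => Finset.filter_subset _ _)
        (fun z _ => Finset.filter_subset _ _)
      rwa [sq])
  have h3 := mutual_information_le A R
  have h4 : fiberEntropy A R + fiberEntropy A Rᶜ =
      ∑ x ∈ A, Real.logb 2 (((fiber A R x).card : ℝ) * (fiber A Rᶜ x).card) := by
    rw [fiberEntropy, fiberEntropy, ← Finset.sum_add_distrib]
    refine Finset.sum_congr rfl fun x hx => ?_
    rw [Real.logb_mul (fiber_card_pos hx).ne' (fiber_card_pos hx).ne']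
  rw [← Finset.sum_sdiff hE] at h4
  have h5 : (A.card : ℝ) = E.card + (A \ E).card := by
    rw [Finset.cast_card_sdiff hE]; ring
  have h6 := splitEntropy_le (a := E.card) (b := (A \ E).card) (by positivity) (by positivity)
  rw [splitEntropy, ← h5] at h6
  rw [Real.logb_mul hq.ne' (by positivity), Real.logb_pow] at h1
  rw [Real.logb_pow] at h2
  rw [one_div, Real.logb_inv]
  have h7 : (A.card : ℝ) * Real.logb 2 A.card =
    E.card * Real.logb 2 A.card + (A \ E).card * Real.logb 2 A.card := by
    rw [← add_mul, ← h5]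
  push_cast at h1 h2
  nlinarith

/-- The directions of the boundary edges at `x`. -/
def bdryDirs (A : Finset (ι → Bool)) (x : ι → Bool) : Finset ι :=
  univ.filter fun k => flipAt k x ∉ A

lemma card_bdryDirs (A : Finset (ι → Bool)) (x : ι → Bool) :
    ((bdryDirs A x).card : ℝ) = Fintype.card ι - deg A x := by
  have := Finset.card_filter_add_card_filter_not (s := (univ : Finset ι)) (fun k => flipAt k x ∈ A)
  rw [card_univ] at this
  rw [bdryDirs, deg, ← this]
  push_cast; ring

lemma sum_bdry (A : Finset (ι → Bool)) : ∑ k, (bdry A k : ℝ) =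
    A.card * (Fintype.card ι - Real.logb 2 A.card) + excess A := by
  simp_rw [bdry_eq]
  rw [Finset.sum_sub_distrib, excess]
  simp
  ring

open Classical in
/-- The directions outside `R` that are predicted both from `R` and from the complement of
`R`. -/
noncomputable def doublyPredicted (A : Finset (ι → Bool)) (R : Finset ι) (x : ι → Bool) :
    Finset ι :=
  Rᶜ.filter fun k => Predicted A R k x ∧ Predicted A (Rᶜ.erase k) k x

open Classical in
lemma card_bdryDirs_inter_le (A : Finset (ι → Bool)) (R : Finset ι) (x : ι → Bool) :
    ((bdryDirs A x ∩ Rᶜ).card : ℝ) ≤ (doublyPredicted A R x).card +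
      (∑ k ∈ Rᶜ, (if flipAt k x ∉ A ∧ ¬ Predicted A R k x then (1 : ℝ) else 0) +
      ∑ k ∈ Rᶜ, (if flipAt k x ∉ A ∧ ¬ Predicted A (Rᶜ.erase k) k x then (1 : ℝ) else 0)) := by
  have e1 : ((bdryDirs A x ∩ Rᶜ).card : ℝ) = ∑ k ∈ Rᶜ, if flipAt k x ∉ A then (1 : ℝ) else 0 := by
    rw [Finset.sum_boole, bdryDirs, Finset.filter_inter, Finset.univ_inter]
  have e2 : ((doublyPredicted A R x).card : ℝ) = ∑ k ∈ Rᶜ,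
      if Predicted A R k x ∧ Predicted A (Rᶜ.erase k) k x then (1 : ℝ) else 0 := by
    rw [Finset.sum_boole, doublyPredicted]
  rw [e1, e2, ← Finset.sum_add_distrib, ← Finset.sum_add_distrib]
  refine Finset.sum_le_sum fun k _ => ?_
  by_cases h1 : flipAt k x ∈ A <;> by_cases h2 : Predicted A R k x <;>
    by_cases h3 : Predicted A (Rᶜ.erase k) k x <;> simp [h1, h2, h3]

open Classical in
/-- In total over `R`, few boundary directions are not doubly predicted. -/
lemma sum_not_doublyPredicted_le (A : Finset (ι → Bool)) :
    ∑ R : Finset ι, ∑ x ∈ A,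
      (∑ k ∈ Rᶜ, (if flipAt k x ∉ A ∧ ¬ Predicted A R k x then (1 : ℝ) else 0) +
      ∑ k ∈ Rᶜ, (if flipAt k x ∉ A ∧ ¬ Predicted A (Rᶜ.erase k) k x then (1 : ℝ) else 0)) ≤
      8 * 2 ^ Fintype.card ι * excess A := by
  have h1 : ∀ R : Finset ι, ∑ x ∈ A, (∑ k ∈ Rᶜ,
      (if flipAt k x ∉ A ∧ ¬ Predicted A R k x then (1 : ℝ) else 0) +
      ∑ k ∈ Rᶜ, (if flipAt k x ∉ A ∧ ¬ Predicted A (Rᶜ.erase k) k x then (1 : ℝ) else 0)) ≤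
      4 * ∑ k ∈ Rᶜ, (fiberEntropy A R - fiberEntropy A (insert k R) - inner A k) +
      4 * excess A := by
    intro R
    rw [Finset.sum_add_distrib, Finset.sum_comm, Finset.sum_comm (s := A)]
    apply add_le_add
    · rw [Finset.mul_sum]
      exact Finset.sum_le_sum fun k hk => card_unpredicted_le A (by simpa using hk)
    · refine le_trans ?_ (mul_le_mul_of_nonneg_left (sum_slack_le A Rᶜ) (by norm_num))
      rw [Finset.mul_sum]
      refine Finset.sum_le_sum fun k hk => ?_
      have := card_unpredicted_le A (R := Rᶜ.erase k) (k := k) (by simp)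
      rwa [Finset.insert_erase hk] at this
  refine (Finset.sum_le_sum fun R _ => h1 R).trans ?_
  rw [Finset.sum_add_distrib, ← Finset.mul_sum, Finset.sum_const, card_univ, Fintype.card_finset]
  have := sum_powerset_slack_le A
  rw [nsmul_eq_mul]
  push_cast
  linarith

open Classical in
lemma sum_indicator_inter_le (D : Finset ι) {L m : ℝ} (hL : 0 < L) (hm : 0 ≤ m)
    (h : L - D.card ≤ m) :
    ∑ R : Finset ι, (if ((D ∩ Rᶜ).card : ℝ) < L / 4 then (1 : ℝ) else 0) ≤
      2 ^ Fintype.card ι * (1 / 2 + m / L) := by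
  -- complementation pairs up the sets `R`; for each pair, at most one is counted twice
  have e : ∑ R : Finset ι, (if ((D ∩ Rᶜ).card : ℝ) < L / 4 then (1 : ℝ) else 0) =
      ∑ R : Finset ι, (if ((D ∩ R).card : ℝ) < L / 4 then (1 : ℝ) else 0) :=
    Finset.sum_nbij' (fun R => Rᶜ) (fun R => Rᶜ) (by simp) (by simp) (by simp) (by simp) (by simp)
  have h2 : ∀ R : Finset ι, (if ((D ∩ Rᶜ).card : ℝ) < L / 4 then (1 : ℝ) else 0) +
      (if ((D ∩ R).card : ℝ) < L / 4 then (1 : ℝ) else 0) ≤ 1 + 2 * (m / L) := by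
    intro R
    have h3 : ((D ∩ R).card : ℝ) + (D ∩ Rᶜ).card = D.card := by
      have := Finset.card_inter_add_card_sdiff D R
      rw [Finset.sdiff_eq_inter_compl] at this
      exact_mod_cast this
    have h0 : 0 ≤ m / L := div_nonneg hm hL.le
    split_ifs with ha hb hb
    · have : L / 2 ≤ m := by linarith
      have : 1 / 2 ≤ m / L := by rw [le_div_iff₀ hL]; linarith
      linarith
    all_goals linarith
  have h3 := Finset.sum_le_sum fun R (_ : R ∈ (univ : Finset (Finset ι))) => h2 R
  rw [Finset.sum_add_distrib, ← e, Finset.sum_const, card_univ, Fintype.card_finset,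
    nsmul_eq_mul] at h3
  push_cast at h3
  linarith

/-- For some `R`, many points of `A` have many doubly predicted directions. -/
lemma exists_many_doublyPredicted (A : Finset (ι → Bool)) {L : ℝ}
    (hL : L = Fintype.card ι - Real.logb 2 A.card) (hL0 : 0 < L)
    (hG : excess A ≤ L / 512 * A.card) :
    ∃ R : Finset ι, (A.card : ℝ) / 4 ≤
      (A.filter fun x => L / 8 ≤ ((doublyPredicted A R x).card : ℝ)).card := by
  classical
  set bad : Finset ι → (ι → Bool) → ℝ := fun R x =>
      (∑ k ∈ Rᶜ, (if flipAt k x ∉ A ∧ ¬ Predicted A R k x then (1 : ℝ) else 0) +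
      ∑ k ∈ Rᶜ, (if flipAt k x ∉ A ∧ ¬ Predicted A (Rᶜ.erase k) k x then (1 : ℝ) else 0)) with hbad
  have hbad0 : ∀ R x, 0 ≤ bad R x := fun R x => by
    rw [hbad]
    exact add_nonneg (Finset.sum_nonneg fun k _ => by split_ifs <;> norm_num)
      (Finset.sum_nonneg fun k _ => by split_ifs <;> norm_num)
  set n := Fintype.card ι
  have h1 : ∀ R x, (if ((doublyPredicted A R x).card : ℝ) < L / 8 then (1 : ℝ) else 0) ≤
      (if ((bdryDirs A x ∩ Rᶜ).card : ℝ) < L / 4 then (1 : ℝ) else 0) + 8 / L * bad R x := by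
    intro R x
    have h2 := card_bdryDirs_inter_le A R x
    have h3 : 0 ≤ 8 / L * bad R x := mul_nonneg (by positivity) (hbad0 R x)
    split_ifs with ha hb hb
    · linarith
    · have : L / 8 ≤ bad R x := by
        rw [hbad]; linarith
      have : 8 / L * (L / 8) ≤ 8 / L * bad R x := by gcongr
      have e : 8 / L * (L / 8) = 1 := by field_simp
      linarith
    · linarith
    · linarith
  by_contra hcon
  push Not at hcon
  have h2 : ∀ R, (3 : ℝ) / 4 * A.card ≤
      ∑ x ∈ A, (if ((doublyPredicted A R x).card : ℝ) < L / 8 then (1 : ℝ) else 0) := by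
    intro R
    have := hcon R
    have e := Finset.card_filter_add_card_filter_not (s := A)
      (fun x => L / 8 ≤ ((doublyPredicted A R x).card : ℝ))
    simp only [not_le] at e
    rw [Finset.sum_boole]
    have e' : ((A.filter fun x => L / 8 ≤ ((doublyPredicted A R x).card : ℝ)).card : ℝ) +
      (A.filter fun x => ((doublyPredicted A R x).card : ℝ) < L / 8).card = A.card := by
      exact_mod_cast e
    linarith
  have h3 := Finset.sum_le_sum fun R (_ : R ∈ (univ : Finset (Finset ι))) => h2 R
  have h4 : ∑ R : Finset ι, ∑ x ∈ A,
      (if ((doublyPredicted A R x).card : ℝ) < L / 8 then (1 : ℝ) else 0) ≤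
      ∑ x ∈ A, 2 ^ n * (1 / 2 + max 0 ((deg A x : ℝ) - Real.logb 2 A.card) / L) +
        8 / L * (8 * 2 ^ n * excess A) := by
    refine (Finset.sum_le_sum fun R _ => Finset.sum_le_sum fun x _ => h1 R x).trans ?_
    simp_rw [Finset.sum_add_distrib (s := A), ← Finset.mul_sum]
    rw [Finset.sum_add_distrib, ← Finset.mul_sum, Finset.sum_comm]
    apply add_le_add
    · rw [Finset.mul_sum]
      refine Finset.sum_le_sum fun x _ => ?_
      refine sum_indicator_inter_le (bdryDirs A x) hL0 (le_max_left _ _) ?_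
      rw [card_bdryDirs, hL]
      exact le_trans (le_of_eq (by ring)) (le_max_right _ _)
    · gcongr
      exact sum_not_doublyPredicted_le A
  rw [← Finset.mul_sum, Finset.sum_add_distrib, ← Finset.sum_div] at h4
  have h5 := sum_deg_sub_logb_le A
  rw [Finset.sum_const, card_univ, Fintype.card_finset, nsmul_eq_mul] at h3
  push_cast at h3
  have h6 : (∑ x ∈ A, max 0 ((deg A x : ℝ) - Real.logb 2 A.card)) / L ≤ 2 * (A.card / 512) := by
    rw [div_le_iff₀ hL0]; linarith
  have h7 : 8 / L * (8 * 2 ^ n * excess A) ≤ 2 ^ n * (A.card / 8) := by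
    have : excess A / L ≤ A.card / 512 := by rw [div_le_iff₀ hL0]; linarith
    calc _ = 64 * 2 ^ n * (excess A / L) := by ring
      _ ≤ 64 * 2 ^ n * (A.card / 512) := by gcongr
      _ = _ := by ring
  simp only [sum_const, nsmul_eq_mul] at h4
  have h8 : (2 : ℝ) ^ n * (3 / 4 * A.card) ≤ 2 ^ n * (A.card * (1 / 2) + 2 * (A.card / 512)) +
      2 ^ n * (A.card / 8) := by
    refine h3.trans (h4.trans (add_le_add ?_ h7))
    rw [Finset.sum_div] at h6
    exact mul_le_mul_of_nonneg_left (by linarith) (by positivity)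
  have h9 : (3 / 4 * A.card : ℝ) ≤ (A.card * (1 / 2) + 2 * (A.card / 512)) + A.card / 8 := by
    rw [← mul_add] at h8
    exact le_of_mul_le_mul_left h8 (by positivity)
  have h10 : (A.card : ℝ) ≤ 0 := by linarith
  have h11 := hcon ∅
  have : (0 : ℝ) ≤ (A.filter fun x => L / 8 ≤ ((doublyPredicted A ∅ x).card : ℝ)).card :=
    Nat.cast_nonneg _
  linarith

/-- A small set with boundary small in every direction has either an excess comparable to the
logarithm of its density or an excess logarithmic in the size of its boundaries: directions of
boundary edges are predicted by a random half of the coordinates and by the other half, so that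
two halves of independent points rarely fit together. -/
lemma excess_ge_of_small_density (A : Finset (ι → Bool)) (hA : A.Nonempty) {L δ : ℝ}
    (hL : L = Fintype.card ι - Real.logb 2 A.card) (hL0 : 0 < L) (hδ : 0 < δ) (hδ1 : 64 * δ ≤ 1)
    (hB : ∀ k, (bdry A k : ℝ) ≤ δ * A.card) (hG : excess A ≤ L / 512 * A.card) :
    A.card * (Real.logb 2 (1 / (64 * δ)) / 4 - 1) ≤ excess A := by
  classical
  obtain ⟨R, hR⟩ := exists_many_doublyPredicted A hL hL0 hG
  set E := A.filter fun x => L / 8 ≤ ((doublyPredicted A R x).card : ℝ) with hE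
  have hN : (0 : ℝ) < A.card := by exact_mod_cast hA.card_pos
  set c : (ι → Bool) → ℝ := fun z => ((fiber A R z).card : ℝ) * (fiber A Rᶜ z).card with hc
  have hc0 : ∀ z, 0 ≤ c z := fun z => by rw [hc]; positivity
  have h1 : ∑ z ∈ E, c z ≤ 8 / L * ∑ z ∈ A, (doublyPredicted A R z).card * c z := by
    rw [Finset.mul_sum]
    refine le_trans (Finset.sum_le_sum (g := fun z => 8 / L * ((doublyPredicted A R z).card * c z))
      fun z hz => ?_) (Finset.sum_le_sum_of_subset_of_nonneg (Finset.filter_subset _ _)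
        fun z _ _ => ?_)
    · have h2 := (mem_filter.1 hz).2
      calc c z = 8 / L * (L / 8 * c z) := by field_simp
        _ ≤ _ := by
          have := hc0 z
          gcongr
    · have := hc0 z
      positivity
  have h2 : ∑ z ∈ A, (doublyPredicted A R z).card * c z ≤
      ∑ k ∈ Rᶜ, (2 * bdry A k) * (2 * bdry A k : ℝ) := by
    have e : ∑ z ∈ A, (doublyPredicted A R z).card * c z = ∑ k ∈ Rᶜ, ∑ z ∈ A.filter
        (fun z => Predicted A R k z ∧ Predicted A (Rᶜ.erase k) k z), c z := by
      simp_rw [Finset.sum_filter]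
      rw [Finset.sum_comm]
      refine Finset.sum_congr rfl fun z _ => ?_
      rw [← Finset.sum_filter, Finset.sum_const, nsmul_eq_mul, doublyPredicted]
    rw [e]
    refine Finset.sum_le_sum fun k hk => ?_
    have hk' : k ∉ R := by simpa using hk
    refine (sum_fiber_mul_fiber_le A _ (A.filter (Predicted A R k))
      (A.filter (Predicted A (Rᶜ.erase k) k)) R ?_ ?_).trans ?_
    · intro z hz x hx
      rw [mem_filter] at hz ⊢
      rw [mem_fiber] at hx
      exact ⟨hx.1, (predicted_congr hx.2).2 hz.2.1⟩
    · intro z hz x hx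
      rw [mem_filter] at hz ⊢
      rw [mem_fiber] at hx
      exact ⟨hx.1, (predicted_congr fun i hi => hx.2 i (Finset.mem_of_mem_erase hi)).2 hz.2.2⟩
    · exact mul_le_mul (card_predicted_le A hk') (card_predicted_le A (by simp))
        (by positivity) (by positivity)
  have h3 : ∑ k ∈ Rᶜ, (2 * bdry A k) * (2 * bdry A k : ℝ) ≤ 8 * δ * L * A.card ^ 2 := by
    calc _ ≤ ∑ k, (2 * bdry A k) * (2 * bdry A k : ℝ) :=
          Finset.sum_le_sum_of_subset_of_nonneg (Finset.subset_univ _)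
            fun k _ _ => by positivity
      _ ≤ ∑ k, 4 * (δ * A.card) * (bdry A k : ℝ) := by
          refine Finset.sum_le_sum fun k _ => ?_
          have := mul_le_mul_of_nonneg_right (hB k) (Nat.cast_nonneg (bdry A k) : (0 : ℝ) ≤ _)
          linarith
      _ = 4 * (δ * A.card) * (A.card * L + excess A) := by
          rw [← Finset.mul_sum, sum_bdry, hL]
      _ ≤ 4 * (δ * A.card) * (A.card * L + L * A.card) := by
          gcongr
          refine hG.trans ?_
          gcongr
          linarith
      _ = _ := by ring
  have h4 : ∑ z ∈ E, c z ≤ (64 * δ) * A.card ^ 2 := by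
    refine h1.trans ((mul_le_mul_of_nonneg_left (h2.trans h3) (by positivity)).trans ?_)
    apply le_of_eq
    field_simp
    norm_num
  have h5 := excess_ge_of_subset A E hA (Finset.filter_subset _ _) R (by positivity) h4
  have h6 : 0 ≤ Real.logb 2 (1 / (64 * δ)) :=
    Real.logb_nonneg (by norm_num) (by rw [le_div_iff₀ (by positivity)]; linarith)
  have h7 := mul_le_mul_of_nonneg_right hR h6
  linarith

end Prediction

/-! ### Walsh functions and the Kahn-Kalai-Linial inequality -/

section Fourier

variable {ι : Type*}

/-- The Walsh function of the coordinates in `S`. -/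
def walsh (S : Finset ι) (x : ι → Bool) : ℝ := ∏ i ∈ S, if x i then -1 else 1

lemma walsh_flipAt [DecidableEq ι] (S : Finset ι) (k : ι) (x : ι → Bool) :
    walsh S (flipAt k x) = (if k ∈ S then -1 else 1) * walsh S x := by
  by_cases hk : k ∈ S
  · rw [if_pos hk, walsh, walsh, ← Finset.mul_prod_erase S _ hk, ← Finset.mul_prod_erase S _ hk,
      flipAt_same, Finset.prod_congr rfl (g := fun i => if x i then (-1 : ℝ) else 1)
        (fun i hi => by rw [flipAt_of_ne (Finset.ne_of_mem_erase hi)])]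
    cases x k <;> simp
  · rw [if_neg hk, one_mul]
    refine Finset.prod_congr rfl fun i hi => ?_
    rw [flipAt_of_ne (by rintro rfl; exact hk hi)]

lemma sum_walsh_mul_walsh [Fintype ι] (x y : ι → Bool) :
    ∑ S : Finset ι, walsh S x * walsh S y = if x = y then 2 ^ Fintype.card ι else 0 := by
  classical
  have e : ∑ S : Finset ι, walsh S x * walsh S y =
      ∏ i, (1 + (if x i then (-1 : ℝ) else 1) * (if y i then -1 else 1)) := by
    rw [Finset.prod_one_add, Finset.powerset_univ]
    exact Finset.sum_congr rfl fun S _ => by rw [walsh, walsh, Finset.prod_mul_distrib]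
  rw [e]
  split_ifs with h
  · subst h
    rw [Finset.prod_congr rfl (g := fun _ => (2 : ℝ)) (fun i _ => by split_ifs <;> norm_num)]
    simp
  · obtain ⟨i, hi⟩ := Function.ne_iff.1 h
    apply Finset.prod_eq_zero (mem_univ i)
    revert hi
    cases x i <;> cases y i <;> simp

variable [Fintype ι] [DecidableEq ι]

/-- The expectation of `g` at a uniformly random point of the cube. -/
noncomputable def avg (g : (ι → Bool) → ℝ) : ℝ := (∑ x, g x) / 2 ^ Fintype.card ι

/-- The Walsh coefficients of `g`. -/
noncomputable def coeff (g : (ι → Bool) → ℝ) (S : Finset ι) : ℝ := avg fun x => g x * walsh S x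

lemma avg_add (f g : (ι → Bool) → ℝ) : avg (fun x => f x + g x) = avg f + avg g := by
  simp [avg, Finset.sum_add_distrib, add_div]

lemma avg_sub (f g : (ι → Bool) → ℝ) : avg (fun x => f x - g x) = avg f - avg g := by
  simp [avg, Finset.sum_sub_distrib, sub_div]

lemma avg_const_mul (c : ℝ) (g : (ι → Bool) → ℝ) : avg (fun x => c * g x) = c * avg g := by
  simp [avg, ← Finset.mul_sum, mul_div_assoc]

lemma avg_sum {α : Type*} (s : Finset α) (g : α → (ι → Bool) → ℝ) :
    avg (fun x => ∑ a ∈ s, g a x) = ∑ a ∈ s, avg (g a) := by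
  simp [avg, Finset.sum_comm (s := univ), Finset.sum_div]

lemma avg_nonneg {g : (ι → Bool) → ℝ} (h : ∀ x, 0 ≤ g x) : 0 ≤ avg g :=
  div_nonneg (Finset.sum_nonneg fun x _ => h x) (by positivity)

lemma avg_flipAt (g : (ι → Bool) → ℝ) (k : ι) : avg (fun x => g (flipAt k x)) = avg g := by
  rw [avg, avg]
  congr 1
  exact Finset.sum_nbij' (fun x => flipAt k x) (fun x => flipAt k x) (by simp) (by simp)
    (fun x _ => flipAt_flipAt k x) (fun x _ => flipAt_flipAt k x) (fun _ _ => rfl)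

lemma avg_mul_sq_le (f g : (ι → Bool) → ℝ) :
    avg (fun x => f x * g x) ^ 2 ≤ avg (fun x => f x ^ 2) * avg (fun x => g x ^ 2) := by
  rw [avg, avg, avg, div_pow, div_mul_div_comm, ← sq]
  exact div_le_div_of_nonneg_right (Finset.sum_mul_sq_le_sq_mul_sq _ _ _) (by positivity)

lemma sum_coeff_mul_walsh (g : (ι → Bool) → ℝ) (x : ι → Bool) :
    ∑ S : Finset ι, coeff g S * walsh S x = g x := by
  simp only [coeff, avg, div_mul_eq_mul_div, ← Finset.sum_div, Finset.sum_mul]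
  rw [Finset.sum_comm]
  simp only [mul_assoc, ← Finset.mul_sum, sum_walsh_mul_walsh]
  simp

lemma avg_mul_sum (g : (ι → Bool) → ℝ) (c : Finset ι → ℝ) :
    avg (fun x => g x * ∑ S, c S * walsh S x) = ∑ S, c S * coeff g S := by
  simp only [Finset.mul_sum]
  rw [avg_sum]
  refine Finset.sum_congr rfl fun S _ => ?_
  rw [coeff, ← avg_const_mul]
  congr 1
  ext x
  ring

/-- Parseval's identity. -/
lemma sum_coeff_sq (g : (ι → Bool) → ℝ) : ∑ S, coeff g S ^ 2 = avg fun x => g x ^ 2 := by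
  have := avg_mul_sum g (coeff g)
  simp only [sum_coeff_mul_walsh, ← sq] at this
  exact this.symm

lemma avg_odd (F : (ι → Bool) → ℝ) (i : ι) (h : ∀ x, F (flipAt i x) = -F x) : avg F = 0 := by
  have := avg_flipAt F i
  simp only [h] at this
  have e : avg (fun x => -F x) = -avg F := by
    have := avg_const_mul (-1) F
    simpa using this
  linarith

/-- Bonami's inequality between the fourth and the second moment, with noise of rate
`1 / √3`. -/
lemma bonami {ρ : ℝ} (hρ : ρ ^ 2 = 1 / 3) (c : Finset ι → ℝ) (T : Finset ι) :
    avg (fun x => (∑ S ∈ T.powerset, ρ ^ S.card * c S * walsh S x) ^ 4) ≤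
      (∑ S ∈ T.powerset, c S ^ 2) ^ 2 := by
  induction T using Finset.induction_on generalizing c with
  | empty =>
    simp [avg, walsh]
    apply le_of_eq; ring
  | insert i T hi ih =>
    set g : (ι → Bool) → ℝ := fun x => ∑ S ∈ T.powerset, ρ ^ S.card * c S * walsh S x with hg
    set h : (ι → Bool) → ℝ := fun x => ∑ S ∈ T.powerset, ρ ^ S.card * c (insert i S) * walsh S x
      with hh
    set s : (ι → Bool) → ℝ := fun x => if x i then -1 else 1 with hs
    have hmem : ∀ S ∈ T.powerset, i ∉ S := fun S hS h => hi (Finset.mem_powerset.1 hS h)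
    have e1 : ∀ x, ∑ S ∈ (insert i T).powerset, ρ ^ S.card * c S * walsh S x =
        g x + ρ * (s x * h x) := by
      intro x
      rw [Finset.sum_powerset_insert hi, hg, hh]
      simp only [Finset.mul_sum]
      congr 1
      refine Finset.sum_congr rfl fun S hS => ?_
      rw [Finset.card_insert_of_notMem (hmem S hS), walsh, Finset.prod_insert (hmem S hS), hs, walsh]
      ring
    have e2 : ∑ S ∈ (insert i T).powerset, c S ^ 2 =
        ∑ S ∈ T.powerset, c S ^ 2 + ∑ S ∈ T.powerset, c (insert i S) ^ 2 :=
      Finset.sum_powerset_insert hi _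
    have ig := ih c
    have ih' := ih fun S => c (insert i S)
    rw [e2]
    simp only [e1]
    set G := ∑ S ∈ T.powerset, c S ^ 2
    set H := ∑ S ∈ T.powerset, c (insert i S) ^ 2
    have hG0 : 0 ≤ G := Finset.sum_nonneg fun S _ => sq_nonneg _
    have hH0 : 0 ≤ H := Finset.sum_nonneg fun S _ => sq_nonneg _
    have hgi : ∀ x, g (flipAt i x) = g x := fun x => by
      rw [hg]
      refine Finset.sum_congr rfl fun S hS => ?_
      rw [walsh_flipAt, if_neg (hmem S hS), one_mul]
    have hhi : ∀ x, h (flipAt i x) = h x := fun x => by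
      rw [hh]
      refine Finset.sum_congr rfl fun S hS => ?_
      rw [walsh_flipAt, if_neg (hmem S hS), one_mul]
    have hsi : ∀ x, s (flipAt i x) = -s x := fun x => by
      rw [hs]; simp only [flipAt_same]; cases x i <;> simp
    have hs2 : ∀ x, s x ^ 2 = 1 := fun x => by
      rw [hs]; simp only; split_ifs <;> norm_num
    have hρ4 : ρ ^ 4 = 1 / 9 := by
      rw [show ρ ^ 4 = (ρ ^ 2) ^ 2 by ring, hρ]; norm_num
    have expand : (fun x => (g x + ρ * (s x * h x)) ^ 4) = fun x =>
        (g x ^ 4 + (2 * (g x ^ 2 * h x ^ 2) + 1 / 9 * h x ^ 4)) +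
        s x * (4 * ρ * (g x ^ 3 * h x) + 4 * ρ / 3 * (g x * h x ^ 3)) := by
      ext x
      have h3 : s x ^ 3 = s x := by rw [pow_succ, hs2, one_mul]
      have h4 : s x ^ 4 = 1 := by rw [show s x ^ 4 = (s x ^ 2) ^ 2 by ring, hs2]; norm_num
      have h5 : ρ ^ 3 = ρ / 3 := by rw [pow_succ, hρ]; ring
      calc (g x + ρ * (s x * h x)) ^ 4 = g x ^ 4 + 6 * ρ ^ 2 * s x ^ 2 * (g x ^ 2 * h x ^ 2) +
            ρ ^ 4 * s x ^ 4 * h x ^ 4 + 4 * ρ * s x * (g x ^ 3 * h x) +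
            4 * ρ ^ 3 * s x ^ 3 * (g x * h x ^ 3) := by ring
        _ = _ := by rw [hρ, hs2, hρ4, h3, h4, h5]; ring
    rw [expand, avg_add, avg_add, avg_add, avg_const_mul, avg_const_mul,
      avg_odd (fun x => s x * _) i (fun x => by rw [hsi, hgi, hhi]; ring), add_zero]
    have hcs := avg_mul_sq_le (fun x => g x ^ 2) (fun x => h x ^ 2)
    simp only [← pow_mul] at hcs
    norm_num at hcs
    have hx : avg (fun x => g x ^ 2 * h x ^ 2) ≤ G * H := by
      apply le_of_sq_le_sq _ (by positivity)
      refine hcs.trans ((mul_le_mul ig ih' (avg_nonneg fun x => by positivity)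
        (by positivity)).trans (le_of_eq (by ring)))
    nlinarith [mul_nonneg hG0 hH0]

/-- The noisy second moment of a function with values in `{0, 1, -1}` is much smaller than the
second moment, when the latter is small. -/
lemma sum_noise_coeff_sq_le (g : (ι → Bool) → ℝ) (hg : ∀ x, g x = 0 ∨ g x = 1 ∨ g x = -1)
    {τ : ℝ} (hτ : avg (fun x => g x ^ 2) ≤ τ) :
    ∑ S, (1 / 3 : ℝ) ^ S.card * coeff g S ^ 2 ≤ Real.sqrt τ * avg fun x => g x ^ 2 := by
  set p := avg fun x => g x ^ 2 with hp
  have hp0 : 0 ≤ p := avg_nonneg fun x => sq_nonneg _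
  set Y := ∑ S, (1 / 3 : ℝ) ^ S.card * coeff g S ^ 2 with hY
  have hY0 : 0 ≤ Y := Finset.sum_nonneg fun S _ => by positivity
  set ρ := Real.sqrt (1 / 3) with hρ'
  have hρ : ρ ^ 2 = 1 / 3 := Real.sq_sqrt (by norm_num)
  set h : (ι → Bool) → ℝ := fun x => ∑ S, (1 / 3 : ℝ) ^ S.card * coeff g S * walsh S x with hh
  have h1 : avg (fun x => g x * h x) = Y := by
    have := avg_mul_sum g (fun S => (1 / 3 : ℝ) ^ S.card * coeff g S)
    rw [hh, this, hY]
    exact Finset.sum_congr rfl fun S _ => by ring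
  have h2 : avg (fun x => h x ^ 4) ≤ Y ^ 2 := by
    have := bonami hρ (fun S => ρ ^ S.card * coeff g S) univ
    rw [Finset.powerset_univ] at this
    have e1 : ∀ S : Finset ι, ρ ^ S.card * (ρ ^ S.card * coeff g S) =
        (1 / 3 : ℝ) ^ S.card * coeff g S := by
      intro S
      rw [← mul_assoc, ← mul_pow, ← sq, hρ]
    have e2 : ∀ S : Finset ι, (ρ ^ S.card * coeff g S) ^ 2 =
        (1 / 3 : ℝ) ^ S.card * coeff g S ^ 2 := by
      intro S
      rw [mul_pow, ← pow_mul, mul_comm S.card 2, pow_mul, hρ]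
    simp only [e1, e2] at this
    exact this
  -- the Cauchy-Schwarz inequality twice
  have h3 : Y ^ 2 ≤ p * avg (fun x => g x ^ 2 * h x ^ 2) := by
    have := avg_mul_sq_le g (fun x => g x * (g x * h x))
    have e1 : (fun x => g x * (g x * (g x * h x))) = fun x => g x * h x := by
      ext x; rcases hg x with h | h | h <;> rw [h] <;> ring
    have e2 : (fun x => (g x * (g x * h x)) ^ 2) = fun x => g x ^ 2 * h x ^ 2 := by
      ext x; rcases hg x with h | h | h <;> rw [h] <;> ring
    rwa [e1, e2, h1] at this
  have h4 : avg (fun x => g x ^ 2 * h x ^ 2) ^ 2 ≤ p * Y ^ 2 := by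
    have := avg_mul_sq_le (fun x => g x ^ 2) (fun x => h x ^ 2)
    have e1 : (fun x => (g x ^ 2) ^ 2) = fun x => g x ^ 2 := by
      ext x; rcases hg x with h | h | h <;> rw [h] <;> ring
    have e2 : (fun x => (h x ^ 2) ^ 2) = fun x => h x ^ 4 := by
      ext x; ring
    rw [e1, e2] at this
    exact this.trans (mul_le_mul_of_nonneg_left h2 hp0)
  have h5 : 0 ≤ avg (fun x => g x ^ 2 * h x ^ 2) := avg_nonneg fun x => by positivity
  rcases hY0.eq_or_lt with h0 | hpos
  · rw [← h0]; positivity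
  have h6 : Y ^ 2 ≤ p ^ 3 := by
    have : (Y ^ 2) ^ 2 ≤ p ^ 3 * Y ^ 2 := by
      calc (Y ^ 2) ^ 2 ≤ (p * avg (fun x => g x ^ 2 * h x ^ 2)) ^ 2 := by gcongr
        _ = p ^ 2 * avg (fun x => g x ^ 2 * h x ^ 2) ^ 2 := by ring
        _ ≤ p ^ 2 * (p * Y ^ 2) := by gcongr
        _ = _ := by ring
    rw [sq (Y ^ 2)] at this
    exact le_of_mul_le_mul_right this (by positivity)
  apply le_of_sq_le_sq _ (by positivity)
  rw [mul_pow, Real.sq_sqrt (hp0.trans hτ)]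
  refine h6.trans ?_
  calc p ^ 3 = p * p ^ 2 := by ring
    _ ≤ τ * p ^ 2 := by gcongr

lemma coeff_sub_flipAt (f : (ι → Bool) → ℝ) (k : ι) (S : Finset ι) :
    coeff (fun x => f x - f (flipAt k x)) S = if k ∈ S then 2 * coeff f S else 0 := by
  have e : avg (fun x => f (flipAt k x) * walsh S x) =
      (if k ∈ S then -1 else 1) * coeff f S := by
    rw [← avg_flipAt _ k, coeff, ← avg_const_mul]
    congr 1
    ext x
    rw [flipAt_flipAt, walsh_flipAt]
    ring
  rw [coeff]
  simp only [sub_mul]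
  rw [avg_sub, e, coeff]
  split_ifs <;> ring

/-- The inequality of Kahn, Kalai and Linial: a Boolean function all of whose influences are at
most `τ` has a total influence at least logarithmic in `1 / τ`, relative to its variance. -/
lemma kahn_kalai_linial (f : (ι → Bool) → ℝ) (hf : ∀ x, f x = 0 ∨ f x = 1) {τ I V : ℝ}
    (hτ : ∀ k, avg (fun x => (f x - f (flipAt k x)) ^ 2) ≤ τ)
    (hI : I = ∑ k, avg (fun x => (f x - f (flipAt k x)) ^ 2))
    (hV : V = avg f - avg f ^ 2) (hV0 : 0 < V) :
    V * (1 / 3 : ℝ) ^ (I / (4 * V)) ≤ Real.sqrt τ * I / 4 := by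
  have hsum : ∀ w : Finset ι → ℝ,
      ∑ k, ∑ S, w S * coeff (fun x => f x - f (flipAt k x)) S ^ 2 =
      4 * ∑ S : Finset ι, S.card * (w S * coeff f S ^ 2) := by
    intro w
    rw [Finset.sum_comm, Finset.mul_sum]
    refine Finset.sum_congr rfl fun S _ => ?_
    have : ∀ k, w S * coeff (fun x => f x - f (flipAt k x)) S ^ 2 =
        if k ∈ S then 4 * (w S * coeff f S ^ 2) else 0 := by
      intro k; rw [coeff_sub_flipAt]; split_ifs <;> ring
    simp only [this]
    rw [Finset.sum_ite_mem, Finset.univ_inter, Finset.sum_const, nsmul_eq_mul]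
    ring
  have h1 : I = 4 * ∑ S : Finset ι, S.card * coeff f S ^ 2 := by
    have := hsum fun _ => 1
    simp only [one_mul, sum_coeff_sq] at this
    rw [hI, this]
  have h2 : 4 * ∑ S : Finset ι, S.card * ((1 / 3 : ℝ) ^ S.card * coeff f S ^ 2) ≤
      Real.sqrt τ * I := by
    rw [← hsum, hI, Finset.mul_sum]
    refine Finset.sum_le_sum fun k _ => sum_noise_coeff_sq_le _ (fun x => ?_) (hτ k)
    rcases hf x with h | h <;> rcases hf (flipAt k x) with h' | h' <;> rw [h, h'] <;> norm_num
  have hV' : V = ∑ S ∈ univ.erase (∅ : Finset ι), coeff f S ^ 2 := by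
    have h3 := sum_coeff_sq f
    rw [← Finset.add_sum_erase univ _ (mem_univ (∅ : Finset ι))] at h3
    have e1 : coeff f ∅ = avg f := by simp [coeff, walsh]
    have e2 : (fun x => f x ^ 2) = f := by
      ext x; rcases hf x with h | h <;> rw [h] <;> norm_num
    rw [e1, e2] at h3
    rw [hV]; linarith
  -- Jensen's inequality, by the tangent of `s ↦ 3⁻ˢ` at the average size of `S`
  set m := I / (4 * V) with hm
  have htan : ∀ S : Finset ι, (1 / 3 : ℝ) ^ m * (1 - (S.card - m) * Real.log 3) ≤
      (1 / 3 : ℝ) ^ S.card := by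
    intro S
    have h3 : (1 / 3 : ℝ) ^ S.card = (1 / 3 : ℝ) ^ m * (1 / 3 : ℝ) ^ ((S.card : ℝ) - m) := by
      rw [← Real.rpow_add (by norm_num), ← Real.rpow_natCast]
      congr 1; ring
    rw [h3]
    apply mul_le_mul_of_nonneg_left _ (by positivity)
    have h4 : (1 / 3 : ℝ) ^ ((S.card : ℝ) - m) = Real.exp (-((S.card - m) * Real.log 3)) := by
      rw [Real.rpow_def_of_pos (by norm_num), one_div, Real.log_inv]
      congr 1; ring
    rw [h4]
    have := Real.add_one_le_exp (-((S.card - m) * Real.log 3))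
    linarith
  have h4 : V * (1 / 3 : ℝ) ^ m ≤
      ∑ S ∈ univ.erase (∅ : Finset ι), (1 / 3 : ℝ) ^ S.card * coeff f S ^ 2 := by
    have h5 : ∑ S ∈ univ.erase (∅ : Finset ι), (S.card : ℝ) * coeff f S ^ 2 = m * V := by
      have : ∑ S : Finset ι, (S.card : ℝ) * coeff f S ^ 2 =
          ∑ S ∈ univ.erase (∅ : Finset ι), (S.card : ℝ) * coeff f S ^ 2 := by
        rw [← Finset.add_sum_erase univ _ (mem_univ (∅ : Finset ι))]
        simp
      rw [← this, hm, h1]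
      field_simp
    refine le_trans (le_of_eq ?_) (Finset.sum_le_sum fun S _ =>
      mul_le_mul_of_nonneg_right (htan S) (sq_nonneg (coeff f S)))
    have e : ∀ S : Finset ι, (1 / 3 : ℝ) ^ m * (1 - (S.card - m) * Real.log 3) * coeff f S ^ 2 =
      (1 / 3 : ℝ) ^ m * (1 + m * Real.log 3) * coeff f S ^ 2 -
      (1 / 3 : ℝ) ^ m * Real.log 3 * (S.card * coeff f S ^ 2) := by
      intro S; ring
    simp only [e]
    rw [Finset.sum_sub_distrib, ← Finset.mul_sum, ← Finset.mul_sum, h5, ← hV']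
    ring
  have h5 : ∑ S ∈ univ.erase (∅ : Finset ι), (1 / 3 : ℝ) ^ S.card * coeff f S ^ 2 ≤
      ∑ S : Finset ι, S.card * ((1 / 3 : ℝ) ^ S.card * coeff f S ^ 2) := by
    refine (Finset.sum_le_sum fun S hS => ?_).trans
      (Finset.sum_le_sum_of_subset_of_nonneg (Finset.subset_univ _) fun S _ _ => by positivity)
    have : (1 : ℝ) ≤ S.card := by
      exact_mod_cast Finset.card_pos.2 (Finset.nonempty_iff_ne_empty.2 (Finset.ne_of_mem_erase hS))
    exact le_mul_of_one_le_left (by positivity) this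
  linarith

end Fourier

/-! ### Sets with small boundary in every direction -/

section SmallInfluences

variable {ι : Type*} [Fintype ι] [DecidableEq ι]

lemma avg_indicator (A : Finset (ι → Bool)) :
    avg (fun x => if x ∈ A then (1 : ℝ) else 0) = A.card / 2 ^ Fintype.card ι := by
  simp [avg]

lemma avg_indicator_sub_flipAt (A : Finset (ι → Bool)) (k : ι) :
    avg (fun x => ((if x ∈ A then (1 : ℝ) else 0) - if flipAt k x ∈ A then (1 : ℝ) else 0) ^ 2) =
      2 * (bdry A k / 2 ^ Fintype.card ι) := by
  have h1 : avg (fun x => if x ∈ A ∧ flipAt k x ∉ A then (1 : ℝ) else 0) =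
      bdry A k / 2 ^ Fintype.card ι := by
    rw [avg, Finset.sum_boole, bdry]
    congr 3
    ext x; simp
  have h2 := avg_flipAt (fun x => if x ∈ A ∧ flipAt k x ∉ A then (1 : ℝ) else 0) k
  rw [h1] at h2
  rw [two_mul]
  nth_rw 1 [← h1]
  rw [← h2, ← avg_add]
  congr 1
  ext x
  rw [flipAt_flipAt]
  by_cases ha : x ∈ A <;> by_cases hb : flipAt k x ∈ A <;> simp [ha, hb]

/-- The Kahn-Kalai-Linial inequality for the boundary of a set, with the bound on the influences
relative to the size of the set. -/
lemma sum_bdry_ge (A : Finset (ι → Bool)) (hA : A.Nonempty) {μ Λ : ℝ}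
    (hμ : μ = A.card / 2 ^ Fintype.card ι) (hμ1 : μ < 1)
    (hB : ∀ k, (bdry A k : ℝ) ≤ (2 : ℝ) ^ (-Λ) * A.card) :
    A.card * ((1 - μ) * ((Λ - 1) / 4)) ≤ ∑ k, (bdry A k : ℝ) := by
  have hN : (0 : ℝ) < A.card := by exact_mod_cast hA.card_pos
  have hn : (0 : ℝ) < 2 ^ Fintype.card ι := by positivity
  have hμ0 : 0 < μ := by rw [hμ]; positivity
  obtain ⟨J, hJ⟩ : ∃ J, J = (∑ k, (bdry A k : ℝ)) / A.card := ⟨_, rfl⟩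
  have hJ0 : 0 ≤ J := by rw [hJ]; positivity
  have hJA : ∑ k, (bdry A k : ℝ) = A.card * J := by
    rw [hJ, mul_div_cancel₀ _ hN.ne']
  have hAμ : (A.card : ℝ) = μ * 2 ^ Fintype.card ι := by
    rw [hμ, div_mul_cancel₀ _ hn.ne']
  have hV0 : 0 < μ - μ ^ 2 := by nlinarith
  have key := kahn_kalai_linial (fun x => if x ∈ A then (1 : ℝ) else 0)
    (fun x => by split_ifs <;> simp) (τ := 2 * (2 : ℝ) ^ (-Λ)) (I := 2 * μ * J)
    (V := μ - μ ^ 2) ?_ ?_ ?_ hV0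
  · obtain ⟨w, hw⟩ : ∃ w, w = J / (1 - μ) := ⟨_, rfl⟩
    have h1μ : 0 < 1 - μ := by linarith
    have hw0 : 0 ≤ w := by rw [hw]; exact div_nonneg hJ0 h1μ.le
    have e1 : 2 * μ * J / (4 * (μ - μ ^ 2)) = w / 2 := by
      rw [hw, show μ - μ ^ 2 = μ * (1 - μ) by ring]
      field_simp
      ring
    rw [e1] at key
    have hJw : J = w * (1 - μ) := by rw [hw]; field_simp
    rw [hJw] at key
    have h3 : (0 : ℝ) < 3 ^ (w / 2) := by positivity
    have e2 : (1 / 3 : ℝ) ^ (w / 2) = (3 ^ (w / 2))⁻¹ := by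
      rw [one_div, Real.inv_rpow (by norm_num)]
    have key2 : 1 ≤ Real.sqrt (2 * (2 : ℝ) ^ (-Λ)) * (w / 2) * 3 ^ (w / 2) := by
      rw [e2] at key
      have h4 : (μ - μ ^ 2) * 1 ≤ (μ - μ ^ 2) *
          (Real.sqrt (2 * (2 : ℝ) ^ (-Λ)) * (w / 2) * 3 ^ (w / 2)) := by
        have := mul_le_mul_of_nonneg_right key h3.le
        rw [mul_assoc, inv_mul_cancel₀ h3.ne'] at this
        refine this.trans (le_of_eq (by ring))
      exact le_of_mul_le_mul_left h4 hV0
    have h5 : w / 2 ≤ 3 ^ (w / 2) := by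
      have h6 : Real.exp (w / 2) ≤ 3 ^ (w / 2) := by
        rw [← Real.exp_one_rpow]
        exact Real.rpow_le_rpow (Real.exp_pos 1).le Real.exp_one_lt_three.le (by positivity)
      linarith [Real.add_one_le_exp (w / 2)]
    have key3 : 1 ≤ Real.sqrt (2 * (2 : ℝ) ^ (-Λ)) * 4 ^ w := by
      refine key2.trans ?_
      rw [mul_assoc]
      apply mul_le_mul_of_nonneg_left _ (Real.sqrt_nonneg _)
      calc w / 2 * 3 ^ (w / 2) ≤ 3 ^ (w / 2) * 3 ^ (w / 2) := by gcongr
        _ = 3 ^ w := by rw [← Real.rpow_add (by norm_num)]; ring_nf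
        _ ≤ 4 ^ w := Real.rpow_le_rpow (by norm_num) (by norm_num) hw0
    have key4 : (Λ - 1) / 4 ≤ w := by
      have e3 : Real.sqrt (2 * (2 : ℝ) ^ (-Λ)) * 4 ^ w = (2 : ℝ) ^ ((1 - Λ) / 2 + 2 * w) := by
        rw [Real.rpow_add (by norm_num), Real.sqrt_eq_rpow, show (4 : ℝ) = 2 ^ (2 : ℝ) by norm_num,
          ← Real.rpow_mul (by norm_num)]
        congr 1
        nth_rw 1 [← Real.rpow_one 2]
        rw [← Real.rpow_add (by norm_num), ← Real.rpow_mul (by norm_num)]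
        congr 1; ring
      rw [e3] at key3
      by_contra hlt
      push Not at hlt
      have : (2 : ℝ) ^ ((1 - Λ) / 2 + 2 * w) < 1 :=
        Real.rpow_lt_one_of_one_lt_of_neg (by norm_num) (by linarith)
      linarith
    rw [hJA, hJw]
    apply mul_le_mul_of_nonneg_left _ hN.le
    rw [mul_comm]
    gcongr
  · intro k
    rw [avg_indicator_sub_flipAt]
    apply mul_le_mul_of_nonneg_left _ (by norm_num)
    rw [div_le_iff₀ hn]
    refine (hB k).trans ?_
    apply mul_le_mul_of_nonneg_left _ (by positivity)
    rw [hAμ]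
    exact mul_le_of_le_one_left hn.le hμ1.le
  · simp only [avg_indicator_sub_flipAt]
    rw [← Finset.mul_sum, ← Finset.sum_div, hJA, hμ]
    ring
  · rw [avg_indicator, ← hμ]

/-- A set whose boundary is small in every direction has a large excess, unless it is nearly the
whole cube. -/
theorem excess_ge_of_bdry_le (A : Finset (ι → Bool)) (hA : A.Nonempty) {Λ : ℝ} (hΛ : 34 ≤ Λ)
    (hB : ∀ k, (bdry A k : ℝ) ≤ (2 : ℝ) ^ (-Λ) * A.card) :
    Λ / 8192 * (A.card * (1 - A.card / 2 ^ Fintype.card ι)) ≤ excess A := by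
  have hN : (0 : ℝ) < A.card := by exact_mod_cast hA.card_pos
  have hn : (0 : ℝ) < 2 ^ Fintype.card ι := by positivity
  set μ : ℝ := A.card / 2 ^ Fintype.card ι with hμ
  have hμ0 : 0 < μ := by positivity
  have hle : (A.card : ℝ) ≤ 2 ^ Fintype.card ι := by
    have := Finset.card_le_univ A
    rw [Fintype.card_fun, Fintype.card_bool] at this
    exact_mod_cast this
  have hμ1 : μ ≤ 1 := by rw [hμ, div_le_one hn]; exact hle
  have hG0 := excess_nonneg A
  rcases hμ1.eq_or_lt with h1 | h1
  · rw [h1]; simpa using hG0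
  set L := Fintype.card ι - Real.logb 2 A.card with hL
  have hLμ : L = -Real.logb 2 μ := by
    rw [hμ, Real.logb_div hN.ne' hn.ne', Real.logb_pow, Real.logb_self_eq_one (by norm_num), hL]
    ring
  have hL0 : 0 < L := by
    rw [hLμ]
    have := Real.logb_neg (b := 2) (by norm_num) hμ0 h1
    linarith
  have hJ := sum_bdry_ge A hA hμ h1 hB
  rw [sum_bdry, ← hL] at hJ
  rcases le_or_gt (1 / 2) μ with h2 | h2
  · -- dense sets: the logarithm of the density is negligible
    have h3 : L ≤ 4 * (1 - μ) := by
      have hl : 1 / 2 ≤ Real.log 2 := by have := Real.log_two_gt_d9; linarith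
      have h4 := logb_two_le μ⁻¹ (by positivity)
      rw [Real.logb_inv, ← hLμ] at h4
      refine h4.trans ?_
      rw [div_le_iff₀ (by linarith)]
      have h5 : μ⁻¹ ≤ 2 := by rw [inv_le_comm₀ hμ0 (by norm_num)]; linarith
      have h6 : μ⁻¹ - 1 = μ⁻¹ * (1 - μ) := by field_simp
      rw [h6]
      nlinarith
    have h4 : (A.card : ℝ) * ((1 - μ) * (Λ / 8)) ≤ excess A := by
      have h5 : (A.card : ℝ) * L ≤ A.card * (4 * (1 - μ)) := by gcongr
      have h6 : (A.card : ℝ) * ((1 - μ) * (Λ / 8)) ≤ A.card * ((1 - μ) * ((Λ - 1) / 4 - 4)) := by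
        have : 0 ≤ 1 - μ := by linarith
        gcongr
        linarith
      linarith
    have h7 : 0 ≤ (A.card : ℝ) * (1 - μ) := mul_nonneg hN.le (by linarith)
    nlinarith
  · have h0 : Λ / 8192 * (A.card * (1 - μ)) ≤ A.card * (Λ / 8192) := by
      have : (A.card : ℝ) * (1 - μ) ≤ A.card * 1 := by gcongr; linarith
      nlinarith
    refine h0.trans ?_
    -- sparse sets: the bound on `L + excess A / |A|` suffices as long as `L` is not too large
    rcases le_or_gt L (Λ / 16) with h3 | h3
    · have h4 : (A.card : ℝ) * ((1 / 2) * ((Λ - 1) / 4)) ≤ A.card * ((1 - μ) * ((Λ - 1) / 4)) := by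
        gcongr <;> linarith
      have h5 : (A.card : ℝ) * L ≤ A.card * (Λ / 16) := by gcongr
      have h6 : (A.card : ℝ) * (Λ / 8192) ≤
          A.card * ((1 / 2) * ((Λ - 1) / 4)) - A.card * (Λ / 16) := by
        rw [← mul_sub]
        gcongr
        linarith
      linarith
    · rcases le_or_gt (excess A) (L / 512 * A.card) with h4 | h4
      · have hδ : 64 * (2 : ℝ) ^ (-Λ) = 2 ^ (6 - Λ) := by
          rw [sub_eq_add_neg, Real.rpow_add (by norm_num)]; norm_num
        have h5 := excess_ge_of_small_density A hA hL hL0 (δ := (2 : ℝ) ^ (-Λ)) (by positivity)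
          (by rw [hδ]; exact Real.rpow_le_one_of_one_le_of_nonpos (by norm_num) (by linarith)) hB h4
        rw [hδ, one_div, Real.logb_inv, Real.logb_rpow (by norm_num) (by norm_num)] at h5
        refine le_trans ?_ h5
        gcongr
        linarith
      · refine le_trans ?_ h4.le
        rw [mul_comm]
        exact mul_le_mul_of_nonneg_right (by linarith) hN.le

end SmallInfluences

section Subcubes

variable {ι : Type*} [DecidableEq ι]

/-- The point with coordinates `a` in `S` and `y` outside `S`. -/
def extend (S : Finset ι) (a : ι → Bool) (y : {k // k ∉ S} → Bool) : ι → Bool :=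
  fun i => if h : i ∉ S then y ⟨i, h⟩ else a i

lemma extend_injective (S : Finset ι) (a : ι → Bool) : Function.Injective (extend S a) := by
  intro y z h
  ext1 ⟨i, hi⟩
  have := congrFun h i
  simpa [extend, hi] using this

lemma extend_flipAt (S : Finset ι) (a : ι → Bool) (k : {k // k ∉ S}) (y : {k // k ∉ S} → Bool) :
    extend S a (flipAt k y) = flipAt k.1 (extend S a y) := by
  ext1 i
  by_cases hi : i ∈ S
  · rw [flipAt_of_ne (by rintro rfl; exact k.2 hi)]
    simp [extend, hi]
  · by_cases hk : i = k.1
    · subst hk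
      rw [flipAt_same]
      have : (⟨k.1, hi⟩ : {k // k ∉ S}) = k := rfl
      simp [extend, hi, flipAt_same]
    · rw [flipAt_of_ne hk]
      simp only [extend, hi, not_false_eq_true, dite_true]
      rw [flipAt_of_ne (fun h => hk (congrArg Subtype.val h))]

lemma exists_extend_eq {S : Finset ι} {a x : ι → Bool} (h : ∀ i ∈ S, x i = a i) :
    ∃ y, extend S a y = x := by
  refine ⟨fun i => x i, ?_⟩
  ext1 i
  by_cases hi : i ∈ S
  · simp [extend, hi, h i hi]
  · simp [extend, hi]

variable [Fintype ι]

/-- The part of `A` in a subcube, in the coordinates of the subcube. -/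
def restrict (A : Finset (ι → Bool)) (S : Finset ι) (a : ι → Bool) :
    Finset ({k // k ∉ S} → Bool) :=
  univ.filter fun y => extend S a y ∈ fiber A S a

lemma mem_restrict {A : Finset (ι → Bool)} {S : Finset ι} {a : ι → Bool}
    {y : {k // k ∉ S} → Bool} : y ∈ restrict A S a ↔ extend S a y ∈ fiber A S a := by
  simp [restrict]

lemma card_restrict_filter (A : Finset (ι → Bool)) (S : Finset ι) (a : ι → Bool)
    (p : ({k // k ∉ S} → Bool) → Prop) (q : (ι → Bool) → Prop) [DecidablePred p]
    [DecidablePred q] (h : ∀ y, p y ↔ q (extend S a y)) :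
    ((restrict A S a).filter p).card = ((fiber A S a).filter q).card := by
  refine Finset.card_bij (fun y _ => extend S a y) ?_
    (fun y _ z _ h => extend_injective S a h) ?_
  · intro y hy
    rw [mem_filter, mem_restrict, h] at hy
    exact mem_filter.2 hy
  · intro x hx
    rw [mem_filter] at hx
    obtain ⟨y, rfl⟩ := exists_extend_eq (mem_fiber.1 hx.1).2
    exact ⟨y, mem_filter.2 ⟨mem_restrict.2 hx.1, (h y).2 hx.2⟩, rfl⟩

lemma card_restrict (A : Finset (ι → Bool)) (S : Finset ι) (a : ι → Bool) :
    (restrict A S a).card = (fiber A S a).card := by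
  have := card_restrict_filter A S a (fun _ => True) (fun _ => True) (by simp)
  simpa using this

lemma inner_restrict (A : Finset (ι → Bool)) (S : Finset ι) (a : ι → Bool) (k : {k // k ∉ S}) :
    inner (restrict A S a) k = inner (fiber A S a) k.1 := by
  apply card_restrict_filter
  intro y
  rw [mem_restrict, extend_flipAt]

lemma inner_fiber_of_mem (A : Finset (ι → Bool)) (S : Finset ι) (a : ι → Bool) {k : ι}
    (hk : k ∈ S) : inner (fiber A S a) k = 0 := by
  rw [inner, Finset.card_eq_zero, Finset.filter_eq_empty_iff]
  intro x hx h
  have h1 := (mem_fiber.1 hx).2 k hk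
  have h2 := (mem_fiber.1 h).2 k hk
  rw [flipAt_same, h1] at h2
  cases h : a k <;> simp [h] at h2

lemma excess_restrict (A : Finset (ι → Bool)) (S : Finset ι) (a : ι → Bool) :
    excess (restrict A S a) = excess (fiber A S a) := by
  rw [excess, excess, card_restrict]
  congr 1
  simp only [inner_restrict]
  rw [← Finset.sum_filter_add_sum_filter_not univ (fun k => k ∉ S)
    (fun k => (inner (fiber A S a) k : ℝ)), Finset.sum_eq_zero (s := univ.filter fun k => ¬ k ∉ S),
    add_zero]
  · exact (Finset.sum_subtype (univ.filter fun k => k ∉ S) (by simp)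
      (fun k => (inner (fiber A S a) k : ℝ))).symm
  · intro k hk
    rw [inner_fiber_of_mem A S a (by simpa using hk), Nat.cast_zero]

lemma card_fiber_univ (S : Finset ι) (a : ι → Bool) :
    ((fiber univ S a).card : ℝ) = 2 ^ (Fintype.card ι - S.card) := by
  rw [← card_restrict]
  have : restrict univ S a = univ := by
    ext y
    rw [mem_restrict, mem_fiber]
    simp only [mem_univ, true_and, iff_true]
    intro i hi
    simp [extend, hi]
  rw [this, card_univ, Fintype.card_fun, Fintype.card_bool, Fintype.card_subtype_compl]
  simp

lemma excess_fiber_ge (A : Finset (ι → Bool)) (S : Finset ι) (a : ι → Bool)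
    (hB : (fiber A S a).Nonempty) {Λ : ℝ} (hΛ : 34 ≤ Λ)
    (h : ∀ k ∉ S, (bdry (fiber A S a) k : ℝ) ≤ (2 : ℝ) ^ (-Λ) * (fiber A S a).card) :
    Λ / 8192 * ((fiber A S a).card * (1 - (fiber A S a).card / (fiber univ S a).card)) ≤
      excess (fiber A S a) := by
  have h1 : (restrict A S a).Nonempty := by
    rw [← Finset.card_pos, card_restrict]; exact hB.card_pos
  have h2 := excess_ge_of_bdry_le (restrict A S a) h1 hΛ (fun k => by
    rw [bdry_eq, inner_restrict, card_restrict, ← bdry_eq]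
    exact h k.1 k.2)
  rwa [card_restrict, excess_restrict, Fintype.card_subtype_compl, Fintype.card_coe,
    ← card_fiber_univ S a] at h2

end Subcubes

/-! ### The tree of subcubes -/

section Tree

variable {ι : Type*} [Fintype ι] [DecidableEq ι]

/-- The point `x` lies in one of the subcubes in the list `P`. A pair `(S, a)` stands for the
subcube of all points that agree with `a` on `S`. -/
def Covered (P : List (Finset ι × (ι → Bool))) (x : ι → Bool) : Prop :=
  ∃ p ∈ P, ∀ i ∈ p.1, x i = p.2 i

open Classical in
/-- The number of points of the subcube `(S, a)` at which `A` differs from the union of the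
subcubes in `P`. -/
noncomputable def errorCount (A : Finset (ι → Bool)) (P : List (Finset ι × (ι → Bool)))
    (S : Finset ι) (a : ι → Bool) : ℕ :=
  ((fiber univ S a).filter fun x => ¬ (x ∈ A ↔ Covered P x)).card

lemma half_fiber (A : Finset (ι → Bool)) {S : Finset ι} {k : ι} (hk : k ∉ S) (a : ι → Bool)
    (b : Bool) : half (fiber A S a) k b = fiber A (insert k S) (Function.update a k b) := by
  ext x
  rw [mem_half, mem_fiber, mem_fiber, Finset.forall_mem_insert, Function.update_self]
  have : (∀ i ∈ S, x i = a i) ↔ (∀ i ∈ S, x i = Function.update a k b i) :=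
    forall₂_congr fun i hi => by
      rw [Function.update_of_ne (by rintro rfl; exact hk hi)]
  rw [this]; tauto

lemma errorCount_nil (A : Finset (ι → Bool)) (S : Finset ι) (a : ι → Bool) :
    errorCount A [] S a = (fiber A S a).card := by
  rw [errorCount]
  congr 1
  ext x
  simp [Covered, mem_fiber]
  tauto

lemma errorCount_singleton (A : Finset (ι → Bool)) (S : Finset ι) (a : ι → Bool) :
    (errorCount A [(S, a)] S a : ℝ) = (fiber univ S a).card - (fiber A S a).card := by
  have h : errorCount A [(S, a)] S a + (fiber A S a).card = (fiber univ S a).card := by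
    rw [errorCount]
    classical
    rw [← Finset.card_filter_add_card_filter_not (s := fiber univ S a) (fun x => x ∈ A), add_comm]
    congr 2
    · ext x
      simp only [mem_fiber, mem_filter, mem_univ, true_and]
      tauto
    · ext x
      simp only [Covered, mem_fiber, mem_filter, mem_univ, true_and, List.mem_singleton,
        exists_eq_left]
      tauto
  rw [← h]; push_cast; ring

/-- Approximations in the two halves of a subcube combine, because a subcube of one half covers
no point of the other half. -/
lemma errorCount_append_le (A : Finset (ι → Bool)) {S : Finset ι} {k : ι} (hk : k ∉ S)
    (a : ι → Bool) (b : Bool) {P P' : List (Finset ι × (ι → Bool))}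
    (hP : ∀ p ∈ P, fiber univ p.1 p.2 ⊆ fiber univ (insert k S) (Function.update a k b))
    (hP' : ∀ p ∈ P', fiber univ p.1 p.2 ⊆ fiber univ (insert k S) (Function.update a k (!b))) :
    errorCount A (P ++ P') S a ≤ errorCount A P (insert k S) (Function.update a k b) +
      errorCount A P' (insert k S) (Function.update a k (!b)) := by
  classical
  rw [errorCount, errorCount, errorCount]
  refine le_trans (Finset.card_le_card ?_) (Finset.card_union_le _ _)
  intro x hx
  rw [mem_filter] at hx
  have hcov : Covered (P ++ P') x ↔ Covered P x ∨ Covered P' x := by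
    simp only [Covered, List.mem_append, or_and_right, exists_or]
  have hval : ∀ (c : Bool) (Q : List (Finset ι × (ι → Bool))),
      (∀ p ∈ Q, fiber univ p.1 p.2 ⊆ fiber univ (insert k S) (Function.update a k c)) →
      Covered Q x → x k = c := by
    rintro c Q hQ ⟨p, hp, hpx⟩
    have := hQ p hp (mem_fiber.2 ⟨mem_univ x, hpx⟩)
    rw [← half_fiber _ hk, mem_half] at this
    exact this.2
  rw [hcov] at hx
  rw [mem_union, mem_filter, mem_filter, ← half_fiber _ hk, ← half_fiber _ hk, mem_half, mem_half]
  by_cases hb : x k = b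
  · have h1 : ¬ Covered P' x := fun h => by
      have := hval _ _ hP' h
      rw [hb] at this; cases b <;> simp at this
    left
    refine ⟨⟨hx.1, hb⟩, ?_⟩
    have := hx.2
    tauto
  · have h1 : ¬ Covered P x := fun h => hb (hval _ _ hP h)
    right
    refine ⟨⟨hx.1, by revert hb; cases x k <;> cases b <;> simp⟩, ?_⟩
    have := hx.2
    tauto

lemma fiber_insert_update_subset {S : Finset ι} {k : ι} (hk : k ∉ S) (a : ι → Bool) (b : Bool) :
    fiber univ (insert k S) (Function.update a k b) ⊆ fiber univ S a := by
  rw [← half_fiber _ hk]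
  exact half_subset _ _ _

/-- The part of `A` in a subcube is approximated by few large subcubes. The subcube is split
along a direction with a large boundary as long as there is one. Each proper split lowers the
excess, and there are at most `t` of them on a branch; a very small half is discarded, which is
paid for by the excess as well; without a direction of large boundary, the subcube is nearly full
or nearly empty. The number `r` is the size of the part of `A` after the last proper split. -/
theorem exists_subcubes_of_fiber (A : Finset (ι → Bool)) {K Λ κ η : ℝ} (T : ℕ) (hK : 0 < K)
    (hΛ : 34 ≤ Λ) (hκK : 2 ≤ κ * K) (hκΛ : 16384 ≤ κ * Λ)
    (hη : η = (2 : ℝ) ^ (-Λ) * 2 ^ (-(K + 2))) (m : ℕ) :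
    ∀ (S : Finset ι) (a : ι → Bool) (t u : ℕ) (r : ℝ), Sᶜ.card = m → t + u = T → 0 < r →
      r / 2 ≤ (fiber A S a).card → ((fiber A S a).card : ℝ) ≤ r →
      A.card * (2 : ℝ) ^ (-((K + 3) * u)) ≤ r →
      ∃ P : List (Finset ι × (ι → Bool)), P.length ≤ 2 ^ t ∧
        (∀ p ∈ P, fiber univ p.1 p.2 ⊆ fiber univ S a) ∧
        (∀ p ∈ P, A.card * (2 : ℝ) ^ (-((K + 3) * T + 1)) ≤ (fiber univ p.1 p.2).card) ∧
        (errorCount A P S a : ℝ) ≤ κ * excess (fiber A S a) + excess (fiber A S a) / (η * (T + 1)) +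
          (fiber A S a).card * (u / (T + 1)) + (r - (fiber A S a).card) := by
  have hη0 : 0 < η := by rw [hη]; positivity
  have hκ0 : 0 < κ := by
    by_contra h
    push Not at h
    nlinarith
  have hT : (0 : ℝ) < T + 1 := by positivity
  induction m using Nat.strong_induction_on with
  | _ m ih =>
  intro S a t u r hm htu hr hr1 hr2 hr3
  set B := fiber A S a with hBdef
  have hB0 : (0 : ℝ) < B.card := by linarith
  have hG0 := excess_nonneg B
  have hu : (u : ℝ) ≤ T := by exact_mod_cast (by omega : u ≤ T)
  have hκG : 0 ≤ κ * excess B := by positivity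
  have hηG : 0 ≤ excess B / (η * (T + 1)) := by positivity
  have huB : 0 ≤ B.card * ((u : ℝ) / (T + 1)) := by positivity
  by_cases hcut : ∃ k ∉ S, ∃ b, ((half B k b).card : ℝ) ≤ 2 ^ (-(K + 2)) * B.card ∧
      (half B k b).card ≤ (half B k (!b)).card
  · -- discard a very small half
    obtain ⟨k, hk, b, hb, hb'⟩ := hcut
    have hsum := card_half B k b
    have hle : ((half B k b).card : ℝ) ≤ (half B k (!b)).card := by exact_mod_cast hb'
    have hb0 : (0 : ℝ) ≤ (half B k b).card := Nat.cast_nonneg _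
    have hdec := splitEntropy_ge_of_unbalanced (K := K) hb0
      (show (0 : ℝ) < (half B k (!b)).card by linarith) (by rwa [← hsum])
    have hinner := inner_le_two_mul B k b
    have hsplit := excess_split B k b
    have hGb := excess_nonneg (half B k b)
    have hGb' := excess_nonneg (half B k (!b))
    have hpay : 2 * ((half B k b).card : ℝ) ≤ κ * (K * (half B k b).card) := by
      rw [← mul_assoc]; gcongr
    have hsmall : κ * (K * (half B k b).card) + κ * excess (half B k (!b)) ≤ κ * excess B := by
      rw [← mul_add]
      gcongr
      linarith
    have hGle : excess (half B k (!b)) ≤ excess B := by nlinarith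
    by_cases hbig : r / 2 ≤ (half B k (!b)).card
    · have hlt : (insert k S)ᶜ.card < m := by
        rw [← hm]
        apply Finset.card_lt_card
        rw [Finset.compl_ssubset_compl]
        exact Finset.ssubset_insert hk
      have hfib := half_fiber A hk a (!b)
      rw [← hBdef] at hfib
      obtain ⟨P, hP1, hP2, hP3, hP4⟩ := ih _ hlt (insert k S) (Function.update a k (!b)) t u r rfl
        htu hr (by rw [← hfib]; exact hbig) (by rw [← hfib]; linarith) hr3
      rw [← hfib] at hP4
      refine ⟨P, hP1, fun p hp => (hP2 p hp).trans (fiber_insert_update_subset hk a _), hP3, ?_⟩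
      have herr := errorCount_append_le A hk a b (P := []) (P' := P) (by simp) hP2
      rw [List.nil_append, errorCount_nil, ← half_fiber A hk a b, ← hBdef] at herr
      have herr' : (errorCount A P S a : ℝ) ≤ (half B k b).card +
          errorCount A P (insert k S) (Function.update a k (!b)) := by exact_mod_cast herr
      have h1 : excess (half B k (!b)) / (η * (T + 1)) ≤ excess B / (η * (T + 1)) := by gcongr
      have h2 : ((half B k (!b)).card : ℝ) * ((u : ℝ) / (T + 1)) ≤ B.card * ((u : ℝ) / (T + 1)) :=
        mul_le_mul_of_nonneg_right (by linarith) (by positivity)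
      linarith
    · refine ⟨[], by simp, by simp, by simp, ?_⟩
      rw [errorCount_nil, ← hBdef]
      push Not at hbig
      have : 0 ≤ κ * excess (half B k (!b)) := by positivity
      linarith
  have hmin : ∀ k ∉ S, ∀ b, 2 ^ (-(K + 2)) * (B.card : ℝ) ≤ (half B k b).card := by
    intro k hk b
    by_contra hlt
    push Not at hlt hcut
    rcases le_total (half B k b).card (half B k (!b)).card with h | h
    · exact absurd (hcut k hk b hlt.le) (not_lt.2 h)
    · have h1 : ((half B k (!b)).card : ℝ) ≤ (half B k b).card := by exact_mod_cast h
      have h2 := hcut k hk (!b) (h1.trans hlt.le)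
      rw [Bool.not_not] at h2
      exact absurd h2 (not_lt.2 h)
  by_cases hbd : ∃ k ∉ S, (2 : ℝ) ^ (-Λ) * B.card < bdry B k
  · -- a proper split
    obtain ⟨k, hk, hkB⟩ := hbd
    obtain ⟨b, hb⟩ := exists_half_le B k
    have hsum := card_half B k b
    have hge := excess_split_ge B k b hb
    have hsplit := excess_split B k b
    have hdec : η * B.card ≤ bdry B k * (half B k b).card / B.card := by
      rw [le_div_iff₀ hB0, hη]
      calc _ = ((2 : ℝ) ^ (-Λ) * B.card) * (2 ^ (-(K + 2)) * B.card) := by ring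
        _ ≤ _ := by
          gcongr
          exact hmin k hk b
    have hGb := excess_nonneg (half B k b)
    have hGb' := excess_nonneg (half B k (!b))
    have hsum_le : excess (half B k b) + excess (half B k (!b)) + η * B.card ≤ excess B := by
      linarith
    have hdiv : (excess (half B k b) + excess (half B k (!b))) / (η * (T + 1)) +
        B.card / (T + 1) ≤ excess B / (η * (T + 1)) := by
      have : (B.card : ℝ) / (T + 1) = η * B.card / (η * (T + 1)) := by field_simp
      rw [this, ← add_div]
      gcongr
    rcases t with _ | t
    · refine ⟨[], by simp, by simp, by simp, ?_⟩
      rw [errorCount_nil, ← hBdef]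
      have hut : (u : ℝ) = T := by exact_mod_cast (by omega : u = T)
      have h1 : (B.card : ℝ) * (u / (T + 1)) + B.card / (T + 1) = B.card := by
        rw [hut]; field_simp
      have h2 : 0 ≤ (excess (half B k b) + excess (half B k (!b))) / (η * (T + 1)) := by positivity
      linarith
    · have hlt : (insert k S)ᶜ.card < m := by
        rw [← hm]
        apply Finset.card_lt_card
        rw [Finset.compl_ssubset_compl]
        exact Finset.ssubset_insert hk
      have hrec : ∀ c, ∃ P : List (Finset ι × (ι → Bool)), P.length ≤ 2 ^ t ∧
          (∀ p ∈ P, fiber univ p.1 p.2 ⊆ fiber univ (insert k S) (Function.update a k c)) ∧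
          (∀ p ∈ P, A.card * (2 : ℝ) ^ (-((K + 3) * T + 1)) ≤ (fiber univ p.1 p.2).card) ∧
          (errorCount A P (insert k S) (Function.update a k c) : ℝ) ≤
            κ * excess (half B k c) + excess (half B k c) / (η * (T + 1)) +
            (half B k c).card * ((u + 1) / (T + 1)) := by
        intro c
        have hfib := half_fiber A hk a c
        rw [← hBdef] at hfib
        have hpos : (0 : ℝ) < (half B k c).card := lt_of_lt_of_le (by positivity) (hmin k hk c)
        obtain ⟨P, hP1, hP2, hP3, hP4⟩ := ih _ hlt (insert k S) (Function.update a k c) t (u + 1)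
          (half B k c).card rfl (by omega) hpos (by rw [← hfib]; linarith) (by rw [hfib])
          (by
            refine le_trans ?_ (hmin k hk c)
            have h1 : A.card * (2 : ℝ) ^ (-((K + 3) * u)) / 2 ≤ B.card := by linarith
            have h2 : (2 : ℝ) ^ (-((K + 3) * ((u + 1 : ℕ) : ℝ))) =
                2 ^ (-(K + 2)) * (2 ^ (-((K + 3) * u)) / 2) := by
              rw [← Real.rpow_sub_one (by norm_num), ← Real.rpow_add (by norm_num)]
              congr 1; push_cast; ring
            rw [h2]
            calc _ = 2 ^ (-(K + 2)) * (A.card * (2 : ℝ) ^ (-((K + 3) * u)) / 2) := by ring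
              _ ≤ _ := by gcongr)
        rw [← hfib, sub_self, add_zero] at hP4
        push_cast at hP4
        exact ⟨P, hP1, hP2, hP3, hP4⟩
      obtain ⟨P, hP1, hP2, hP3, hP4⟩ := hrec b
      obtain ⟨P', hP1', hP2', hP3', hP4'⟩ := hrec (!b)
      refine ⟨P ++ P', ?_, ?_, ?_, ?_⟩
      · rw [List.length_append, pow_succ]; omega
      · intro p hp
        rcases List.mem_append.1 hp with h | h
        · exact (hP2 p h).trans (fiber_insert_update_subset hk a _)
        · exact (hP2' p h).trans (fiber_insert_update_subset hk a _)
      · intro p hp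
        rcases List.mem_append.1 hp with h | h
        · exact hP3 p h
        · exact hP3' p h
      · have herr := errorCount_append_le A hk a b hP2 hP2'
        have herr' : (errorCount A (P ++ P') S a : ℝ) ≤
            errorCount A P (insert k S) (Function.update a k b) +
            errorCount A P' (insert k S) (Function.update a k (!b)) := by exact_mod_cast herr
        have h1 : κ * (excess (half B k b) + excess (half B k (!b))) ≤ κ * excess B := by
          gcongr
          have : 0 ≤ η * B.card := by positivity
          linarith
        have h2 : ((half B k b).card : ℝ) * ((u + 1) / (T + 1)) +
            (half B k (!b)).card * ((u + 1) / (T + 1)) =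
            B.card * (u / (T + 1)) + B.card / (T + 1) := by
          rw [hsum]; ring
        rw [add_div] at hdiv
        linarith
  · -- no direction with a large boundary
    push Not at hbd
    have hne : (fiber A S a).Nonempty := by
      rw [← Finset.card_pos]; exact_mod_cast hB0
    have hstar := excess_fiber_ge A S a hne hΛ hbd
    rw [← hBdef] at hstar
    set Q := fiber univ S a with hQ
    have hBQ : (B.card : ℝ) ≤ Q.card := by
      exact_mod_cast Finset.card_le_card (fun x hx => by
        rw [hQ, mem_fiber]; exact ⟨mem_univ x, (mem_fiber.1 hx).2⟩)
    have hQ0 : (0 : ℝ) < Q.card := by linarith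
    have hloss : 2 * (B.card * (1 - B.card / Q.card : ℝ)) ≤ κ * excess B := by
      have h0 : 0 ≤ B.card * (1 - B.card / Q.card : ℝ) := by
        apply mul_nonneg hB0.le
        rw [sub_nonneg, div_le_one hQ0]; exact hBQ
      calc 2 * (B.card * (1 - B.card / Q.card : ℝ)) =
            16384 / 8192 * (B.card * (1 - B.card / Q.card : ℝ)) := by ring
        _ ≤ κ * Λ / 8192 * (B.card * (1 - B.card / Q.card : ℝ)) := by gcongr
        _ = κ * (Λ / 8192 * (B.card * (1 - B.card / Q.card : ℝ))) := by ring
        _ ≤ _ := by gcongr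
    rcases le_total (Q.card / 2 : ℝ) B.card with h | h
    · refine ⟨[(S, a)], by simpa using Nat.one_le_two_pow, by simp [hQ], ?_, ?_⟩
      · intro p hp
        rw [List.mem_singleton] at hp
        subst hp
        refine le_trans ?_ hBQ
        refine le_trans ?_ hr1
        rw [neg_add, ← sub_eq_add_neg, Real.rpow_sub_one (by norm_num), mul_div_assoc']
        apply div_le_div_of_nonneg_right _ (by norm_num)
        refine le_trans ?_ hr3
        gcongr
        norm_num
      · rw [errorCount_singleton, ← hBdef, ← hQ]
        have : (Q.card : ℝ) - B.card ≤ 2 * (B.card * (1 - B.card / Q.card : ℝ)) := by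
          have e : 2 * (B.card * (1 - B.card / Q.card : ℝ)) =
              (2 * B.card / Q.card) * (Q.card - B.card) := by field_simp
          rw [e]
          apply le_mul_of_one_le_left (by linarith)
          rw [le_div_iff₀ hQ0]; linarith
        linarith
    · refine ⟨[], by simp, by simp, by simp, ?_⟩
      rw [errorCount_nil, ← hBdef]
      have : (B.card : ℝ) / Q.card ≤ 1 / 2 := by rw [div_le_iff₀ hQ0]; linarith
      have : (B.card : ℝ) ≤ 2 * (B.card * (1 - B.card / Q.card : ℝ)) := by nlinarith
      linarith

end Tree

/-! ### Boolean functions and disjunctive normal forms -/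

/-- The points at which `f` takes the value `1`. -/
def support {n : ℕ} (f : Cube n → Bool) : Finset (Cube n) := univ.filter fun x => f x = true

lemma mem_support {n : ℕ} {f : Cube n → Bool} {x : Cube n} : x ∈ support f ↔ f x = true := by
  simp [support]

lemma mean_eq {n : ℕ} (f : Cube n → Bool) : mean f = (support f).card / 2 ^ n := by
  simp [mean, support]

lemma influence_eq {n : ℕ} (f : Cube n → Bool) (k : Fin n) :
    influence f k = 2 * (bdry (support f) k / 2 ^ n) := by
  have h := avg_indicator_sub_flipAt (support f) k
  rw [Fintype.card_fin] at h
  rw [← h, influence, prob, avg, Fintype.card_fin]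
  congr 1
  rw [Finset.card_filter]
  push_cast
  refine Finset.sum_congr rfl fun x _ => ?_
  simp only [mem_support]
  change (if f x ≠ f (flipAt k x) then (1 : ℝ) else 0) = _
  cases f x <;> cases f (flipAt k x) <;> simp

lemma excess_support_le {n : ℕ} (f : Cube n → Bool) {M : ℝ} (hne : (support f).Nonempty)
    (h : totalInfluence f ≤ 2 * mean f * (Real.logb 2 (1 / mean f) + M)) :
    excess (support f) ≤ M * (support f).card := by
  have hN : (0 : ℝ) < (support f).card := by exact_mod_cast hne.card_pos
  have h2 : (0 : ℝ) < 2 ^ n := by positivity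
  have h1 : totalInfluence f = 2 * ((∑ k, (bdry (support f) k : ℝ)) / 2 ^ n) := by
    rw [totalInfluence, Finset.sum_div, Finset.mul_sum]
    exact Finset.sum_congr rfl fun k _ => influence_eq f k
  rw [h1, sum_bdry, Fintype.card_fin, mean_eq, one_div, Real.logb_inv,
    Real.logb_div hN.ne' h2.ne', Real.logb_pow, Real.logb_self_eq_one (by norm_num)] at h
  have h3 : ((support f).card * (n - Real.logb 2 (support f).card) + excess (support f)) / 2 ^ n ≤
      (support f).card * (-(Real.logb 2 (support f).card - n * 1) + M) / 2 ^ n := by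
    refine le_of_mul_le_mul_left (h.trans (le_of_eq ?_)) (by norm_num : (0 : ℝ) < 2)
    ring
  rw [div_le_div_iff_of_pos_right h2] at h3
  linarith

/-- The term whose satisfying points form the subcube of all points that agree with `a` on
`S`. -/
def subcubeTerm {n : ℕ} (p : Finset (Fin n) × Cube n) : Term n where
  literals := p.1.image fun i => (i, p.2 i)
  consistent := by
    rintro i ⟨h1, h2⟩
    simp only [Finset.mem_image, Prod.mk.injEq] at h1 h2
    obtain ⟨j, _, rfl, hj⟩ := h1
    obtain ⟨l, _, rfl, hl⟩ := h2
    rw [hj] at hl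
    exact absurd hl (by simp)

lemma subcubeTerm_eval {n : ℕ} (p : Finset (Fin n) × Cube n) (x : Cube n) :
    (subcubeTerm p).eval x = true ↔ ∀ i ∈ p.1, x i = p.2 i := by
  simp [Term.eval, subcubeTerm]

lemma subcubeTerm_card {n : ℕ} (p : Finset (Fin n) × Cube n) :
    (subcubeTerm p).literals.card = p.1.card :=
  Finset.card_image_of_injective _ fun _ _ h => (Prod.mk.inj h).1

/-- The disjunction of the subcubes in a list. -/
def subcubeDNF {n : ℕ} (P : List (Finset (Fin n) × Cube n)) : DNF n := ⟨P.map subcubeTerm⟩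

lemma subcubeDNF_eval {n : ℕ} (P : List (Finset (Fin n) × Cube n)) (x : Cube n) :
    (subcubeDNF P).eval x = true ↔ Covered P x := by
  simp [subcubeDNF, DNF.eval, Covered, subcubeTerm_eval]

lemma subcubeDNF_width_le {n : ℕ} (P : List (Finset (Fin n) × Cube n)) {w : ℝ} (hw : 0 ≤ w)
    (h : ∀ p ∈ P, (p.1.card : ℝ) ≤ w) : ((subcubeDNF P).width : ℝ) ≤ w := by
  rw [DNF.width, subcubeDNF]
  induction P with
  | nil => simpa using hw
  | cons p P ih =>
    simp only [List.map_cons, List.foldr_cons, Nat.cast_max, subcubeTerm_card]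
    exact max_le (h p (by simp)) (ih fun q hq => h q (by simp [hq]))

lemma subcubeDNF_approximates {n : ℕ} (f : Cube n → Bool) (P : List (Finset (Fin n) × Cube n))
    {ε : ℝ} (a : Cube n) (h : (errorCount (support f) P ∅ a : ℝ) ≤ ε * (support f).card) :
    Approximates (ε * mean f) (subcubeDNF P).eval f := by
  rw [Approximates, prob, mean_eq, mul_div_assoc']
  apply div_le_div_of_nonneg_right _ (by positivity)
  refine le_trans (le_of_eq ?_) h
  rw [errorCount]
  congr 2
  ext x
  simp only [mem_filter, mem_univ, true_and, mem_fiber, notMem_empty, IsEmpty.forall_iff,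
    implies_true, mem_support, ← subcubeDNF_eval]
  cases f x <;> cases (subcubeDNF P).eval x <;> simp

/-- The number `T` of proper splits allowed on a branch, and the resulting bound on the
codimension, are at most exponential in `x = M / ε`: for tiny `x` no split is allowed at all. -/
lemma budget_le {x K : ℝ} {T : ℕ} (hx : 0 < x) (hK : K = 34 + 32768 * x)
    (hT : T = ⌊x * 2 ^ (2 * K + 3)⌋₊) :
    (K + 3) * T + 1 ≤ (2 : ℝ) ^ ((109 * 2 ^ (100 : ℕ) + 98305) * x) := by
  rcases Nat.eq_zero_or_pos T with h0 | hpos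
  · rw [h0]
    simpa using Real.one_le_rpow (x := 2) (by norm_num)
      (by positivity : 0 ≤ (109 * 2 ^ (100 : ℕ) + 98305) * x)
  have hT1 : (1 : ℝ) ≤ T := by exact_mod_cast hpos
  have hTle : (T : ℝ) ≤ x * 2 ^ (2 * K + 3) := by
    rw [hT]; exact Nat.floor_le (by positivity)
  have hpow : ∀ y : ℝ, 0 ≤ y → y ≤ 2 ^ y := by
    intro y hy
    rcases le_total y 1 with h1 | h1
    · exact h1.trans (Real.one_le_rpow (by norm_num) hy)
    · have h2 := one_add_mul_self_le_rpow_one_add (s := 1) (by norm_num) h1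
      norm_num at h2
      linarith
  -- a positive `T` forces a lower bound on `x`, which absorbs the constant terms of the exponent
  have hxlow : 1 ≤ 2 ^ (100 : ℕ) * x := by
    by_contra hlt
    push Not at hlt
    have h1 : 2 * K + 3 ≤ 72 := by
      rw [hK]
      norm_num at hlt
      linarith
    have h2 : x * 2 ^ (2 * K + 3) ≤ x * 2 ^ (72 : ℝ) := by gcongr; norm_num
    norm_num at h2 hlt
    linarith
  calc (K + 3) * T + 1 ≤ (K + 3) * T + T := by linarith
    _ = (K + 4) * T := by ring
    _ ≤ 2 ^ (K + 4) * (2 ^ x * 2 ^ (2 * K + 3)) := by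
        have h1 : (0 : ℝ) ≤ K + 4 := by rw [hK]; positivity
        refine mul_le_mul (hpow _ h1) (hTle.trans ?_) (by positivity) (by positivity)
        gcongr
        exact hpow x hx.le
    _ = 2 ^ (109 + 98305 * x) := by
        rw [← Real.rpow_add (by norm_num), ← Real.rpow_add (by norm_num), hK]
        congr 1; ring
    _ ≤ _ := by
        apply Real.rpow_le_rpow_of_exponent_le (by norm_num)
        nlinarith

end BoolFun

theorem theorem1p5 :
    ∃ C : ℝ, 0 < C ∧ ∀ M ε : ℝ, 0 < M → 0 < ε →
      ∃ s : ℕ, (s : ℝ) ≤ (2 : ℝ) ^ ((2 : ℝ) ^ (C * (M / ε))) ∧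
        ∀ (n : ℕ) (f : BoolFun.Cube n → Bool),
          BoolFun.totalInfluence f ≤
            2 * BoolFun.mean f * (Real.logb 2 (1 / BoolFun.mean f) + M) →
          (∃ D : BoolFun.DNF n, D.size ≤ s ∧
            BoolFun.Approximates (ε * BoolFun.mean f) D.eval f) ∧
          (∃ D : BoolFun.DNF n,
            (D.width : ℝ) ≤
              Real.logb 2 (1 / BoolFun.mean f) + (2 : ℝ) ^ (C * (M / ε)) ∧
            BoolFun.Approximates (ε * BoolFun.mean f) D.eval f) := by
  refine ⟨109 * 2 ^ (100 : ℕ) + 98305, by positivity, fun M ε hM hε => ?_⟩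
  obtain ⟨x, hx⟩ : ∃ x, x = M / ε := ⟨_, rfl⟩
  have hx0 : 0 < x := by rw [hx]; positivity
  -- `K` makes the cost of discarding and of the final subcubes at most half of the allowed error,
  -- and `T` does the same for the branches with more than `T` proper splits
  obtain ⟨K, hK⟩ : ∃ K, K = 34 + 32768 * x := ⟨_, rfl⟩
  have hK34 : 34 ≤ K := by rw [hK]; linarith
  obtain ⟨T, hT⟩ : ∃ T, T = ⌊x * 2 ^ (2 * K + 3)⌋₊ := ⟨_, rfl⟩
  have hbudget := BoolFun.budget_le hx0 hK hT
  rw [← hx]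
  obtain ⟨W, hW⟩ : ∃ W, W = (2 : ℝ) ^ ((109 * 2 ^ (100 : ℕ) + 98305) * x) := ⟨_, rfl⟩
  rw [← hW] at hbudget ⊢
  refine ⟨2 ^ T, ?_, fun n f hf => ?_⟩
  · push_cast
    rw [← Real.rpow_natCast]
    apply Real.rpow_le_rpow_of_exponent_le (by norm_num)
    nlinarith [Nat.cast_nonneg (α := ℝ) T]
  have hmain : ∃ P : List (Finset (Fin n) × BoolFun.Cube n), P.length ≤ 2 ^ T ∧
      (∀ p ∈ P, (p.1.card : ℝ) ≤ Real.logb 2 (1 / BoolFun.mean f) + W) ∧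
      BoolFun.Approximates (ε * BoolFun.mean f) (BoolFun.subcubeDNF P).eval f := by
    rcases (BoolFun.support f).eq_empty_or_nonempty with he | hne
    · -- `f = 0` is the empty disjunction, which has no codimension to bound
      refine ⟨[], by simp, by simp, ?_⟩
      apply BoolFun.subcubeDNF_approximates f [] (fun _ => true)
      rw [BoolFun.errorCount_nil, BoolFun.fiber_empty, he]
      simp
    · have hN : (0 : ℝ) < (BoolFun.support f).card := by exact_mod_cast hne.card_pos
      have hG := BoolFun.excess_support_le f hne hf
      have hG0 := BoolFun.excess_nonneg (BoolFun.support f)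
      obtain ⟨κ, hκ⟩ : ∃ κ, κ = 16384 / K := ⟨_, rfl⟩
      have hκK : κ * K = 16384 := by rw [hκ]; field_simp
      obtain ⟨η, hη⟩ : ∃ η, η = (2 : ℝ) ^ (-K) * 2 ^ (-(K + 2)) := ⟨_, rfl⟩
      have hη0 : 0 < η := by rw [hη]; positivity
      obtain ⟨P, hP1, -, hP3, hP4⟩ := BoolFun.exists_subcubes_of_fiber (BoolFun.support f)
        (K := K) (Λ := K) (κ := κ) (η := η) T (by linarith) hK34 (by rw [hκK]; norm_num) hκK.ge
        hη _ ∅ (fun _ => true) T 0 (BoolFun.support f).card rfl (by simp) hN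
        (by rw [BoolFun.fiber_empty]; linarith) (by rw [BoolFun.fiber_empty]) (by simp)
      rw [BoolFun.fiber_empty] at hP4
      refine ⟨P, hP1, fun p hp => ?_, BoolFun.subcubeDNF_approximates f P (fun _ => true) ?_⟩
      · have h1 := hP3 p hp
        have h2 := Real.logb_le_logb_of_le (b := 2) (by norm_num) (by positivity) h1
        have h3 : p.1.card ≤ n := by simpa using Finset.card_le_univ p.1
        rw [BoolFun.card_fiber_univ, Real.logb_mul hN.ne' (by positivity),
          Real.logb_rpow (by norm_num) (by norm_num), Real.logb_pow,
          Real.logb_self_eq_one (by norm_num), Fintype.card_fin, Nat.cast_sub h3] at h2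
        rw [BoolFun.mean_eq, one_div, Real.logb_inv, Real.logb_div hN.ne' (by positivity),
          Real.logb_pow, Real.logb_self_eq_one (by norm_num)]
        linarith
      · refine hP4.trans ?_
        have h1 : κ ≤ 1 / (2 * x) := by
          rw [hκ, div_le_div_iff₀ (by linarith) (by positivity), hK]
          linarith
        have h2 : 1 / (η * (T + 1)) ≤ 1 / (2 * x) := by
          apply one_div_le_one_div_of_le (by positivity)
          have h3 : x * 2 ^ (2 * K + 3) ≤ T + 1 := by
            rw [hT]; exact (Nat.lt_floor_add_one _).le
          have h4 : η * (x * 2 ^ (2 * K + 3)) = 2 * x := by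
            have : η * 2 ^ (2 * K + 3) = 2 := by
              rw [hη, ← Real.rpow_add (by norm_num), ← Real.rpow_add (by norm_num)]
              ring_nf
              norm_num
            rw [mul_left_comm, this]; ring
          rw [← h4]
          gcongr
        have h3 : M = ε * x := by rw [hx, mul_div_cancel₀ _ hε.ne']
        calc _ = (κ + 1 / (η * (T + 1))) * BoolFun.excess (BoolFun.support f) := by
              push_cast; ring
          _ ≤ (1 / (2 * x) + 1 / (2 * x)) * (M * (BoolFun.support f).card) := by gcongr
          _ = ε * (BoolFun.support f).card * (x * x⁻¹) := by rw [h3]; ring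
          _ = _ := by rw [mul_inv_cancel₀ hx0.ne', mul_one]
  -- this includes the case `mean f = 0`, in which the logarithm is `0`
  have hlog : 0 ≤ Real.logb 2 (1 / BoolFun.mean f) := by
    rw [one_div, Real.logb_inv, neg_nonneg]
    have h1 : BoolFun.mean f ≤ 1 := by
      rw [BoolFun.mean_eq, div_le_one (by positivity)]
      have := Finset.card_le_univ (BoolFun.support f)
      rw [Fintype.card_fun, Fintype.card_bool, Fintype.card_fin] at this
      exact_mod_cast this
    have h0 : 0 ≤ BoolFun.mean f := by rw [BoolFun.mean_eq]; positivity
    exact Real.logb_nonpos (by norm_num) h0 h1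
  have hW0 : 0 ≤ W := by rw [hW]; positivity
  obtain ⟨P, h1, h2, h3⟩ := hmain
  refine ⟨⟨BoolFun.subcubeDNF P, ?_, h3⟩, ⟨BoolFun.subcubeDNF P, ?_, h3⟩⟩
  · simpa [BoolFun.DNF.size, BoolFun.subcubeDNF] using h1
  · exact BoolFun.subcubeDNF_width_le P (by linarith) h2
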